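/- \textbf{Conventions.} A randomized word-RAM algorithm is a fixed finite program for a random access machine with words of $w=c\lfloor\log_2 n\rfloor+d=O(\log n)$ bits ($c,d\ge 1$ constants of the algorithm, $n$ the size parameter of the input), with the usual unit-cost arithmetic, bitwise, comparison, jump, and indirect memory instructions, an instruction that draws a uniformly random word, and an instruction that reads an entry of the adjacency matrix of the input graph. It solves a (promise) decision problem in time $T(n)$ if for all sufficiently large $n$, on every input with size parameter $n$ that satisfies the promise, it halts with the correct answer within $T(n)$ steps with probability at least $2/3$. A problem \emph{needs time} $M(n)^{1-o(1)}$ if for no $\delta>0$ there is a randomized word-RAM algorithm that solves it in time $O(M(n)^{1-\delta})$. Fix a field $F$, and let $\mathsf{MM}(p,q,r)$ be the minimum number of arithmetic operations ($+,-,\times$ in $F$) needed to multiply a $p\times q$ matrix by a $q\times r$ matrix; non-integral dimensions are rounded up. \textbf{Unbalanced triangle hypothesis.} For every constant $b\in[0,1]$, deciding whether a given tripartite graph with vertex set $A\sqcup B\sqcup C$ (the parts being given), $|A|=|C|=n$ and $|B|=\lceil n^b\rceil$, contains a triangle needs time $\mathsf{MM}(n,n^b,n)^{1-o(1)}$ (here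 $n$ is the size parameter). \textbf{Theorem.} Assume the unbalanced triangle hypothesis. Let $h\ge 3$ be a constant integer and let $t=t(n)$ be a real-valued function with $1\le t(n)\le n^{h-2}$ for all large $n$ and $t(n)=n^{\gamma+o(1)}$ for some constant $\gamma$. Then distinguishing, given a (loopless) directed graph $G$ on $n$ vertices, between the case that $G$ contains no directed $h$-cycle and the case that $G$ contains at least $t(n)$ directed $h$-cycles (counted as subgraphs) needs time $$\mathsf{MM}\bigl(n,\;n/t^{1/(h-2)},\;n\bigr)^{1-o(1)}.$$ If $h$ is odd, the same holds for (simple) undirected graphs and undirected $h$-cycles. -/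

import Mathlib

open Filter Topology MeasureTheory

/-! ## Randomized word-RAM programs -/

namespace WordRAM

/-- The unit-cost binary operations on words. -/
inductive BinOp
  | add | sub | mul | div | mod | and | or | xor | shl | shr

/-- Evaluation of a binary operation on `w`-bit words; arithmetic is modulo `2 ^ w`, division by
zero gives `0`, and shifting by `w` or more positions gives `0`. -/
def BinOp.eval {w : ℕ} : BinOp → BitVec w → BitVec w → BitVec w
  | .add, x, y => x + y
  | .sub, x, y => x - y
  | .mul, x, y => x * y
  | .div, x, y => x / y
  | .mod, x, y => x % y
  | .and, x, y => x &&& y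
  | .or, x, y => x ||| y
  | .xor, x, y => x ^^^ y
  | .shl, x, y => x <<< y.toNat
  | .shr, x, y => x >>> y.toNat

/-- Instructions. `r_i` is the `i`-th register, `M` the random access memory, `l` a line number.
* `const d k`: `r_d := k mod 2 ^ w`
* `op o d a b`: `r_d := o r_a r_b`
* `load d a`: `r_d := M[r_a]`
* `store a b`: `M[r_a] := r_b`
* `input d a b`: `r_d := 1` if entry `(r_a, r_b)` of the (read-only) input matrix is set, else `0`
* `rand d`: `r_d :=` a fresh uniformly random word
* `jlt a b l`: if `r_a < r_b` (as unsigned numbers) go to line `l`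
* `jeq a b l`: if `r_a = r_b` go to line `l`
* `halt v`: stop with the answer `v` -/
inductive Instr
  | const (d k : ℕ)
  | op (o : BinOp) (d a b : ℕ)
  | load (d a : ℕ)
  | store (a b : ℕ)
  | input (d a b : ℕ)
  | rand (d : ℕ)
  | jlt (a b l : ℕ)
  | jeq (a b l : ℕ)
  | halt (v : Bool)

/-- A program is a finite list of instructions; it mentions only finitely many registers. -/
abbrev Program := List Instr

/-- A configuration of the machine with `w`-bit words: program counter, registers, memory (`2 ^ w`
words), number of random words used so far, and the answer, if the machine has halted. -/
structure Config (w : ℕ) where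
  pc : ℕ
  reg : ℕ → BitVec w
  mem : BitVec w → BitVec w
  rnd : ℕ
  out : Option Bool

/-- The initial configuration: the first registers hold the given numbers (the sizes of the input),
everything else is zero. -/
def Config.init (w : ℕ) (sizes : List ℕ) : Config w where
  pc := 0
  reg i := BitVec.ofNat w (sizes.getD i 0)
  mem _ := 0
  rnd := 0
  out := none

/-- Write the word `x` to register `d` and go to the next line. -/
def Config.write {w : ℕ} (s : Config w) (d : ℕ) (x : BitVec w) : Config w :=
  { s with pc := s.pc + 1, reg := Function.update s.reg d x }

/-- The effect of one instruction, with input matrix `inp` and random words `ρ`. -/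
def Instr.exec {w : ℕ} (inp : ℕ → ℕ → Bool) (ρ : ℕ → Fin (2 ^ w)) (s : Config w) :
    Instr → Config w
  | .const d k => s.write d (BitVec.ofNat w k)
  | .op o d a b => s.write d (o.eval (s.reg a) (s.reg b))
  | .load d a => s.write d (s.mem (s.reg a))
  | .store a b => { s with pc := s.pc + 1, mem := Function.update s.mem (s.reg a) (s.reg b) }
  | .input d a b =>
      s.write d (if inp (s.reg a).toNat (s.reg b).toNat then BitVec.ofNat w 1 else 0)
  | .rand d => { s.write d (BitVec.ofFin (ρ s.rnd)) with rnd := s.rnd + 1 }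
  | .jlt a b l => { s with pc := if (s.reg a).toNat < (s.reg b).toNat then l else s.pc + 1 }
  | .jeq a b l => { s with pc := if s.reg a = s.reg b then l else s.pc + 1 }
  | .halt v => { s with out := some v }

/-- One time step. A machine that has halted stays as it is, and so does a machine whose program
counter points outside the program (it never gives an answer). -/
def step {w : ℕ} (P : Program) (inp : ℕ → ℕ → Bool) (ρ : ℕ → Fin (2 ^ w)) (s : Config w) :
    Config w :=
  match s.out, P[s.pc]? with
  | none, some I => I.exec inp ρ s
  | _, _ => s

/-- The configuration after `T` time steps. -/
def run {w : ℕ} (P : Program) (sizes : List ℕ) (inp : ℕ → ℕ → Bool) (ρ : ℕ → Fin (2 ^ w))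
    (T : ℕ) : Config w :=
  (step P inp ρ)^[T] (Config.init w sizes)

/-- The law of an infinite sequence of independent uniformly random `w`-bit words. -/
noncomputable def tape (w : ℕ) : Measure (ℕ → Fin (2 ^ w)) :=
  Measure.infinitePi fun _ => (PMF.uniformOfFintype (Fin (2 ^ w))).toMeasure

/-- A word-RAM algorithm: one program for all inputs, together with the word size
`c * ⌊log₂ n⌋ + d`, where `c, d ≥ 1` are constants, so that a word can hold the number `n`. -/
structure Algorithm where
  prog : Program
  c : ℕ
  d : ℕ
  one_le_c : 1 ≤ c
  one_le_d : 1 ≤ d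

/-- The word size for inputs of size parameter `n`. -/
def Algorithm.wordSize (𝒜 : Algorithm) (n : ℕ) : ℕ := 𝒜.c * Nat.log 2 n + 𝒜.d

/-- On the input matrix `inp` with size parameter `n`, and with the numbers `sizes` in its first
registers, the algorithm halts with the answer `v` within `T` steps, with probability at
least `2 / 3`. -/
def Algorithm.Answers (𝒜 : Algorithm) (n : ℕ) (sizes : List ℕ) (inp : ℕ → ℕ → Bool) (v : Bool)
    (T : ℝ) : Prop :=
  2 / 3 ≤ tape (𝒜.wordSize n) {ρ | (run 𝒜.prog sizes inp ρ ⌊T⌋₊).out = some v}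

end WordRAM

/-- The adjacency matrix of a binary relation on `Fin n`; entries outside the range are not set. -/
noncomputable def adjInput {n : ℕ} (R : Fin n → Fin n → Prop) (i j : ℕ) : Bool := by
  classical exact decide (∃ (hi : i < n) (hj : j < n), R ⟨i, hi⟩ ⟨j, hj⟩)

/-! ## The complexity of rectangular matrix multiplication -/

section Arithmetic

open MvPolynomial

/-- What is available at no cost after the polynomials in `g` have been computed: these, the
variables and the constants. -/
def Available {σ F : Type*} [Field F] (g : List (MvPolynomial σ F)) (x : MvPolynomial σ F) : Prop :=
  x ∈ g ∨ (∃ i, x = X i) ∨ ∃ a, x = C a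

/-- `g` lists, latest first, the results of the operations of a straight-line program over `F`,
each of which is an addition, a subtraction or a multiplication. -/
inductive IsStraightLine {σ F : Type*} [Field F] : List (MvPolynomial σ F) → Prop
  | nil : IsStraightLine []
  | cons {g : List (MvPolynomial σ F)} {x y z : MvPolynomial σ F} :
      IsStraightLine g → Available g x → Available g y →
      (z = x + y ∨ z = x - y ∨ z = x * y) → IsStraightLine (z :: g)

/-- `MM F p q r` is the number of arithmetic operations in `F` that are needed to multiply a
`p × q` matrix by a `q × r` matrix. -/
noncomputable def MM (F : Type*) [Field F] (p q r : ℕ) : ℕ :=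
  sInf {L | ∃ g : List (MvPolynomial ((Fin p × Fin q) ⊕ (Fin q × Fin r)) F),
    IsStraightLine g ∧ g.length = L ∧
    ∀ i k, Available g (∑ j, X (Sum.inl (i, j)) * X (Sum.inr (j, k)))}

end Arithmetic

/-! ## Triangle detection in unbalanced tripartite graphs -/

/-- The parts of the vertex set `Fin (n + m + n)`: the first `n` vertices form part `0`, the next
`m` part `1`, the last `n` part `2`. -/
def part (n m : ℕ) (v : Fin (n + m + n)) : Fin 3 :=
  if v.val < n then 0 else if v.val < n + m then 1 else 2

/-- `G` is tripartite with parts of sizes `n`, `m`, `n`. -/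
def IsTripartite (n m : ℕ) (G : SimpleGraph (Fin (n + m + n))) : Prop :=
  ∀ u v, G.Adj u v → part n m u ≠ part n m v

/-- The algorithm decides, within `T` steps and with success probability at least `2 / 3`, whether a
tripartite graph with parts of sizes `n`, `m`, `n` contains a triangle. It is given `n` and `m`. -/
def DetectsTriangle (𝒜 : WordRAM.Algorithm) (n m : ℕ) (T : ℝ) : Prop :=
  ∀ G : SimpleGraph (Fin (n + m + n)), IsTripartite n m G →
    (G.CliqueFree 3 → 𝒜.Answers n [n, m] (adjInput G.Adj) false T) ∧
    (¬ G.CliqueFree 3 → 𝒜.Answers n [n, m] (adjInput G.Adj) true T)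

/-- For every constant `b ∈ [0, 1]`, triangle detection in tripartite graphs with parts of sizes
`n`, `n ^ b`, `n` takes time `MM(n, n ^ b, n) ^ (1 - o(1))`: for no `δ > 0` is there a randomized
word-RAM algorithm that takes time `O(MM(n, n ^ b, n) ^ (1 - δ))`. -/
def UnbalancedTriangleHypothesis (F : Type*) [Field F] : Prop :=
  ∀ b : ℝ, 0 ≤ b → b ≤ 1 → ∀ δ : ℝ, 0 < δ →
    ¬ ∃ (𝒜 : WordRAM.Algorithm) (K : ℝ), ∀ᶠ n : ℕ in atTop,
      DetectsTriangle 𝒜 n ⌈(n : ℝ) ^ b⌉₊ (K * (MM F n ⌈(n : ℝ) ^ b⌉₊ n : ℝ) ^ (1 - δ))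

/-! ## Distinguishing graphs without `h`-cycles from graphs with many `h`-cycles -/

/-- The number of directed `h`-cycles (as subgraphs, given by their sets of arcs) of a digraph. -/
noncomputable def Digraph.cycleCount {V : Type*} (G : Digraph V) (h : ℕ) : ℕ :=
  {E : Set (V × V) | ∃ f : ZMod h → V, Function.Injective f ∧ (∀ i, G.Adj (f i) (f (i + 1))) ∧
    E = Set.range fun i => (f i, f (i + 1))}.ncard

/-- The algorithm distinguishes, within `T` steps and with success probability at least `2 / 3`,
between (loopless) directed graphs on `n` vertices without `h`-cycles and those with at least `t`
`h`-cycles. It is given `n`. -/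
def DistinguishesDirected (𝒜 : WordRAM.Algorithm) (h n : ℕ) (t : ℝ) (T : ℝ) : Prop :=
  ∀ G : Digraph (Fin n), (∀ v, ¬ G.Adj v v) →
    (G.cycleCount h = 0 → 𝒜.Answers n [n] (adjInput G.Adj) false T) ∧
    (t ≤ G.cycleCount h → 𝒜.Answers n [n] (adjInput G.Adj) true T)

/-- The same for undirected graphs. -/
def DistinguishesUndirected (𝒜 : WordRAM.Algorithm) (h n : ℕ) (t : ℝ) (T : ℝ) : Prop :=
  ∀ G : SimpleGraph (Fin n),
    (G.copyCount (SimpleGraph.cycleGraph h) = 0 → 𝒜.Answers n [n] (adjInput G.Adj) false T) ∧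
    (t ≤ G.copyCount (SimpleGraph.cycleGraph h) → 𝒜.Answers n [n] (adjInput G.Adj) true T)

/-! ## Simulation of word-RAM programs -/

namespace WordRAM

section Step

variable {w : ℕ} {P : Program} {inp : ℕ → ℕ → Bool} {ρ : ℕ → Fin (2 ^ w)}

/-! The proof is a reduction. Put `H = h - 2`, and take a tripartite graph with parts of sizes `N`,
`m`, `N`. Blow it up into `H + 2` cyclically arranged layers of `L = 2 ^ q * N` vertices each: layer
`0` consists of copies of the first part, layer `H + 1` of copies of the last part, and the `H`
layers in between of copies of the middle part. Consecutive middle layers join copies of the same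
vertex; the other consecutive layers carry the edges of the graph.

Each arc advances the layer by one modulo `H + 2`, so a directed cycle of length `H + 2` meets every
layer once and keeps one middle vertex throughout, which gives a triangle
(`exists_triangle_of_cycle`). Without orientations the layer changes by `±1`; for odd length, parity
forces all signs to agree (`exists_triangle_of_odd_cycle`). Conversely, any choice of one copy per
layer of the vertices of a triangle is a cycle, so there are at least `2 ^ q * 2 ^ q * (L / m) ^ H`
of them.

With `m` about `N ^ (1 - γ / H - η)` this number exceeds `t` (`eventually_le_cycles`). The inner
dimension `n / t ^ (1 / H)` is then larger than `m` by a factor of at most about `N ^ (2 * η)`.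
Cutting the matrix product into blocks, together with `N ^ 2 ≤ MM F N m N`, shows that the two
complexities agree up to an exponent `1 + η` (`eventually_MM_le`).

The blow-up is never written down: an entry of its adjacency matrix is a fixed expression in one
pair of vertices. An algorithm for cycles is therefore simulated with constant overhead, each query
being replaced by straight-line code (`WordRAM.Algorithm.Answers.simulation`,
`WordRAM.Expr.indicates_arc`). -/

theorem step_eq_exec {s : Config w} {I : Instr} (hs : s.out = none) (hI : P[s.pc]? = some I) :
    step P inp ρ s = I.exec inp ρ s := by
  simp [step, hs, hI]

theorem step_eq_self_of_out {s : Config w} {v : Bool} (hs : s.out = some v) :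
    step P inp ρ s = s := by
  simp [step, hs]

theorem step_eq_self_of_pc {s : Config w} (hs : P[s.pc]? = none) : step P inp ρ s = s := by
  unfold step
  rw [hs]
  cases s.out <;> rfl

theorem iterate_step_out {s : Config w} {v : Bool} (hs : s.out = some v) (k : ℕ) :
    (step P inp ρ)^[k] s = s :=
  Function.iterate_fixed (step_eq_self_of_out hs) k

theorem run_out_mono {sizes : List ℕ} {v : Bool} {T T' : ℕ} (hT : T ≤ T')
    (hv : (run P sizes inp ρ T).out = some v) : (run P sizes inp ρ T').out = some v := by
  obtain ⟨k, rfl⟩ := Nat.exists_eq_add_of_le' hT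
  unfold run at *
  rw [Function.iterate_add_apply, iterate_step_out hv, hv]

end Step

/-- The line `p + j` of `P` is the `j`-th instruction of `l`. -/
def Segment (P : Program) (p : ℕ) (l : List Instr) : Prop :=
  ∀ j < l.length, P[p + j]? = l[j]?

theorem Segment.head {P : Program} {p : ℕ} {I : Instr} {l : List Instr}
    (hs : Segment P p (I :: l)) : P[p]? = some I := by
  simpa using hs 0 (by simp)

theorem Segment.tail {P : Program} {p : ℕ} {I : Instr} {l : List Instr}
    (hs : Segment P p (I :: l)) : Segment P (p + 1) l := by
  intro j hj
  have := hs (j + 1) (by simpa using hj)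
  simpa [Nat.add_assoc, Nat.add_comm 1] using this

theorem Segment.left {P : Program} {p : ℕ} {l l' : List Instr}
    (hs : Segment P p (l ++ l')) : Segment P p l := by
  intro j hj
  rw [hs j (by simp; omega), List.getElem?_append_left hj]

theorem Segment.right {P : Program} {p : ℕ} {l l' : List Instr}
    (hs : Segment P p (l ++ l')) : Segment P (p + l.length) l' := by
  intro j hj
  have := hs (l.length + j) (by simp; omega)
  rw [List.getElem?_append_right (by omega)] at this
  simpa [Nat.add_assoc] using this

/-! ### Compilation of expressions into straight-line code. -/

/-- Expressions in the registers. -/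
inductive Expr
  | var (i : ℕ)
  | const (k : ℕ)
  | op (o : BinOp) (x y : Expr)
  | input (x y : Expr)

/-- The value of an expression. -/
def Expr.eval {w : ℕ} (inp : ℕ → ℕ → Bool) (r : ℕ → BitVec w) : Expr → BitVec w
  | .var i => r i
  | .const k => BitVec.ofNat w k
  | .op o x y => o.eval (x.eval inp r) (y.eval inp r)
  | .input x y =>
      if inp (x.eval inp r).toNat (y.eval inp r).toNat then BitVec.ofNat w 1 else 0

/-- The expression mentions only registers below `R`. -/
def Expr.Below (R : ℕ) : Expr → Prop
  | .var i => i < R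
  | .const _ => True
  | .op _ x y => x.Below R ∧ y.Below R
  | .input x y => x.Below R ∧ y.Below R

/-- The number of nodes of an expression. -/
def Expr.size : Expr → ℕ
  | .var _ => 1
  | .const _ => 1
  | .op _ x y => x.size + y.size + 1
  | .input x y => x.size + y.size + 1

/-- Straight-line code that writes the value of an expression to register `d`, using the registers
from `d` on as a stack. -/
def Expr.code : Expr → ℕ → List Instr
  | .var i, d => [.op .or d i i]
  | .const k, d => [.const d k]
  | .op o x y, d => x.code d ++ (y.code (d + 1) ++ [.op o d d (d + 1)])
  | .input x y, d => x.code d ++ (y.code (d + 1) ++ [.input d d (d + 1)])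

theorem Expr.length_code (e : Expr) (d : ℕ) : (e.code d).length = e.size := by
  induction e generalizing d <;> simp_all [Expr.code, Expr.size, Nat.add_assoc]

theorem Expr.eval_congr {w : ℕ} {inp : ℕ → ℕ → Bool} {r r' : ℕ → BitVec w} {R : ℕ} {e : Expr}
    (he : e.Below R) (hr : ∀ i < R, r i = r' i) : e.eval inp r = e.eval inp r' := by
  induction e with
  | var i => exact hr i he
  | const k => rfl
  | op o x y hx hy => simp only [Expr.eval, hx he.1, hy he.2]
  | input x y hx hy => simp only [Expr.eval, hx he.1, hy he.2]

/-- `s'` arises from `s` by executing `k` lines of code that computes the value `x` in register `d`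
and leaves the memory and the registers below `d` unchanged. -/
structure Computed {w : ℕ} (s s' : Config w) (k d : ℕ) (x : BitVec w) : Prop where
  pc : s'.pc = s.pc + k
  mem : s'.mem = s.mem
  rnd : s'.rnd = s.rnd
  out : s'.out = none
  reg : s'.reg d = x
  reg_lt : ∀ i < d, s'.reg i = s.reg i

/-- The common inductive step for `op` and `input`: the second operand is computed from register `d
+ 1` on, so the first one survives in register `d`. -/
theorem Computed.binary {w : ℕ} {P : Program} {inp : ℕ → ℕ → Bool} {ρ : ℕ → Fin (2 ^ w)}
    {s s₁ s₂ : Config w} {k l d : ℕ} {x y z : BitVec w} {I : Instr} (c₁ : Computed s s₁ k d x)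
    (c₂ : Computed s₁ s₂ l (d + 1) y) (hP : P[s₂.pc]? = some I)
    (hI : ∀ s' : Config w, s'.reg d = x → s'.reg (d + 1) = y → I.exec inp ρ s' = s'.write d z) :
    Computed s (step P inp ρ s₂) (k + l + 1) d z := by
  rw [step_eq_exec c₂.out hP, hI s₂ (by rw [c₂.reg_lt d (by omega), c₁.reg]) c₂.reg]
  constructor
  · simp [Config.write, c₂.pc, c₁.pc]; omega
  · simp [Config.write, c₂.mem, c₁.mem]
  · simp [Config.write, c₂.rnd, c₁.rnd]
  · simp [Config.write, c₂.out]
  · simp [Config.write]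
  · intro i hi
    simp [Config.write, Function.update_of_ne hi.ne, c₂.reg_lt i (by omega), c₁.reg_lt i hi]

theorem Expr.computed_code {w : ℕ} {P : Program} {inp : ℕ → ℕ → Bool} {ρ : ℕ → Fin (2 ^ w)}
    {R : ℕ} {e : Expr} (he : e.Below R) {d : ℕ} (hd : R ≤ d) {s : Config w} (hs : s.out = none)
    (hP : Segment P s.pc (e.code d)) :
    Computed s ((step P inp ρ)^[e.size] s) e.size d (e.eval inp s.reg) := by
  induction e generalizing d s with
  | var i =>
    have : (step P inp ρ)^[(Expr.var i).size] s = s.write d (s.reg i) := by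
      simp only [Expr.size, Function.iterate_one]
      rw [step_eq_exec hs hP.head]
      simp [Instr.exec, BinOp.eval]
    rw [this]
    constructor <;> simp +contextual [Config.write, Expr.size, Expr.eval, hs, ne_of_lt]
  | const k =>
    have : (step P inp ρ)^[(Expr.const k).size] s = s.write d (BitVec.ofNat w k) := by
      simp only [Expr.size, Function.iterate_one]
      rw [step_eq_exec hs hP.head]
      simp [Instr.exec]
    rw [this]
    constructor <;> simp +contextual [Config.write, Expr.size, Expr.eval, hs, ne_of_lt]
  | op o x y hx hy | input x y hx hy =>
    have c₁ := hx he.1 hd hs hP.left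
    have hP₁ := hP.right
    rw [Expr.length_code, ← c₁.pc] at hP₁
    have c₂ := hy he.2 (by omega : R ≤ d + 1) c₁.out hP₁.left
    have hP₂ := hP₁.right
    rw [Expr.length_code, ← c₂.pc] at hP₂
    rw [Expr.size, add_comm x.size y.size, Function.iterate_succ_apply',
      Function.iterate_add_apply, add_comm y.size x.size]
    refine c₁.binary c₂ hP₂.head fun s' h₁ h₂ => ?_
    rw [Expr.eval_congr he.2 fun i hi => c₁.reg_lt i (by omega)] at h₂
    simp only [Instr.exec, Expr.eval, h₁, h₂]

/-! ### Step-by-step simulation with a different input matrix. -/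

/-- A number exceeding all register numbers in an instruction. -/
def Instr.bound : Instr → ℕ
  | .const d _ => d + 1
  | .op _ d a b => d + a + b + 1
  | .load d a => d + a + 1
  | .store a b => a + b + 1
  | .input d a b => d + a + b + 1
  | .rand d => d + 1
  | .jlt a b _ => a + b + 1
  | .jeq a b _ => a + b + 1
  | .halt _ => 0

/-- The code that simulates the line `l` of a program, which is `I`. The line `l` starts at
`base + K * l` in the simulating program, and reading the input is replaced by evaluating an
expression with the help of the registers from `R` on. -/
def simBlock (E : ℕ → ℕ → Expr) (R K base l : ℕ) : Instr → List Instr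
  | .input d a b => (E a b).code R ++ [.op .or d R R, .jeq 0 0 (base + K * (l + 1))]
  | .jlt a b l' => [.jlt a b (base + K * l'), .jeq 0 0 (base + K * (l + 1))]
  | .jeq a b l' => [.jeq a b (base + K * l'), .jeq 0 0 (base + K * (l + 1))]
  | .halt v => [.halt v]
  | I => [I, .jeq 0 0 (base + K * (l + 1))]

/-- The program that executes `pre` and then simulates `P`. -/
def simProgram (E : ℕ → ℕ → Expr) (R K : ℕ) (pre P : Program) : Program :=
  pre ++ (List.range (K * P.length)).map fun i =>
    ((P[i / K]?).bind fun I => (simBlock E R K pre.length (i / K) I)[i % K]?).getD (.halt false)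

theorem segment_simProgram_pre {E : ℕ → ℕ → Expr} {R K : ℕ} {pre P : Program} :
    Segment (simProgram E R K pre P) 0 pre := by
  intro j hj
  simp [simProgram, List.getElem?_append_left hj]

/-- All blocks are padded to the same length `K`, so quotient and remainder by `K` recover the
simulated line and the position in its block. The filler lies behind an unconditional jump or a
halt. -/
theorem segment_simProgram {E : ℕ → ℕ → Expr} {R K : ℕ} {pre P : Program} {l : ℕ} {I : Instr}
    (hl : P[l]? = some I) (hK : (simBlock E R K pre.length l I).length ≤ K) :
    Segment (simProgram E R K pre P) (pre.length + K * l) (simBlock E R K pre.length l I) := by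
  intro j hj
  have hlP : l < P.length := (List.getElem?_eq_some_iff.1 hl).1
  have hjK : j < K := hj.trans_le hK
  have h₁ : (K * l + j) / K = l := by
    rw [Nat.mul_add_div (by omega), Nat.div_eq_of_lt hjK, add_zero]
  have h₂ : (K * l + j) % K = j := by rw [Nat.mul_add_mod, Nat.mod_eq_of_lt hjK]
  have h₃ : K * l + j < K * P.length :=
    calc K * l + j < K * (l + 1) := by rw [Nat.mul_succ]; omega
      _ ≤ _ := Nat.mul_le_mul_left K hlP
  rw [simProgram, List.getElem?_append_right (by omega)]
  rw [show pre.length + K * l + j - pre.length = K * l + j by omega, List.getElem?_map,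
    List.getElem?_range h₃, Option.map_some, h₁, h₂, hl, Option.bind_some,
    List.getElem?_eq_getElem hj, Option.getD_some]

/-- The configuration `s'` of the simulating program corresponds to `s`; the registers `R` and
`R + 1` hold the parameters `x` and `y`. -/
structure Simulates {w : ℕ} (R K base : ℕ) (x y : BitVec w) (s s' : Config w) : Prop where
  pc : s'.pc = base + K * s.pc
  reg : ∀ i < R, s'.reg i = s.reg i
  mem : s'.mem = s.mem
  rnd : s'.rnd = s.rnd
  out : s'.out = s.out
  fst : s'.reg R = x
  snd : s'.reg (R + 1) = y

/-- The expressions `E a b` look up an entry of the matrix `inp'` in the matrix `inp`. -/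
structure Lookup {w : ℕ} (inp inp' : ℕ → ℕ → Bool) (R K : ℕ) (x y : BitVec w)
    (E : ℕ → ℕ → Expr) : Prop where
  size : ∀ a b, (E a b).size + 2 ≤ K
  below : ∀ a < R, ∀ b < R, (E a b).Below (R + 2)
  eval : ∀ a < R, ∀ b < R, ∀ r : ℕ → BitVec w, r R = x → r (R + 1) = y →
    (E a b).eval inp r = if inp' (r a).toNat (r b).toNat then BitVec.ofNat w 1 else 0

/-- Registers below `R` belong to the simulated program, `R` and `R + 1` hold the sizes of the
parts, and those from `R + 2` on are scratch space for expressions. The memory is left entirely to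
the simulated program, which may address all of it. -/
theorem Simulates.step {w : ℕ} {inp inp' : ℕ → ℕ → Bool} {R K : ℕ} {x y : BitVec w}
    {E : ℕ → ℕ → Expr} (hE : Lookup inp inp' R K x y E) {pre P : Program}
    (hR : ∀ I ∈ P, I.bound ≤ R) {ρ : ℕ → Fin (2 ^ w)} {s s' : Config w}
    (hs : Simulates R K pre.length x y s s') :
    ∃ k ≤ K, Simulates R K pre.length x y (step P inp' ρ s)
      ((step (simProgram E (R + 2) K pre P) inp ρ)^[k] s') := by
  rcases ho : s.out with _ | v
  swap
  · exact ⟨0, K.zero_le, by rwa [step_eq_self_of_out ho]⟩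
  rcases hI : P[s.pc]? with _ | I
  -- A program that has left its own text is stuck, and the simulation simply takes no step.
  · exact ⟨0, K.zero_le, by rwa [step_eq_self_of_pc hI]⟩
  rw [step_eq_exec ho hI]
  have hIR := hR I (List.mem_of_getElem? hI)
  have ho' : s'.out = none := hs.out.trans ho
  have hK2 : 2 ≤ K := le_trans (by omega) (hE.size 0 0)
  have hlen : (simBlock E (R + 2) K pre.length s.pc I).length ≤ K := by
    cases I with
    | input d a b => simpa [simBlock, Expr.length_code] using hE.size a b
    | _ => simp [simBlock]; omega
  have hseg := segment_simProgram hI hlen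
  rw [← hs.pc] at hseg
  -- Comparing register `0` with itself makes `jeq 0 0` an unconditional jump.
  have jump {s₁ : Config w} {l : ℕ} (h₁ : s₁.out = none)
      (h₂ : Segment (simProgram E (R + 2) K pre P) s₁.pc [.jeq 0 0 l]) :
      WordRAM.step (simProgram E (R + 2) K pre P) inp ρ s₁ = { s₁ with pc := l } := by
    rw [step_eq_exec h₁ h₂.head]
    simp [Instr.exec]
  have two (s₁ : Config w) (J : Instr) (hJ : simBlock E (R + 2) K pre.length s.pc I =
        [J, .jeq 0 0 (pre.length + K * (s.pc + 1))])
      (h₀ : J.exec inp ρ s' = s₁) (h₁ : s₁.out = none) (h₂ : s₁.pc = s'.pc + 1)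
      (hsim : Simulates R K pre.length x y (I.exec inp' ρ s)
        { s₁ with pc := pre.length + K * (s.pc + 1) }) :
      ∃ k ≤ K, Simulates R K pre.length x y (I.exec inp' ρ s)
        ((WordRAM.step (simProgram E (R + 2) K pre P) inp ρ)^[k] s') := by
    rw [hJ] at hseg
    refine ⟨2, hK2, ?_⟩
    rw [Function.iterate_succ_apply, Function.iterate_one, step_eq_exec ho' hseg.head, h₀,
      jump h₁ (h₂ ▸ hseg.tail)]
    exact hsim
  have writes (d : ℕ) (hd : d < R) (z : BitVec w) : Simulates R K pre.length x y (s.write d z)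
      { s'.write d z with pc := pre.length + K * (s.pc + 1) } := by
    constructor
    · rfl
    · intro i hi
      simp only [Config.write, Function.update_apply, hs.reg i hi]
    · exact hs.mem
    · exact hs.rnd
    · exact hs.out
    · simpa [Config.write, Function.update_apply, hd.ne'] using hs.fst
    · simpa [Config.write, Function.update_apply, (hd.trans (Nat.lt_succ_self R)).ne'] using hs.snd
  have jumps (a b l : ℕ) (c : Prop) [Decidable c] (c' : Prop) [Decidable c'] (hc : c ↔ c')
      (J : Instr) (hJ : simBlock E (R + 2) K pre.length s.pc I =
        [J, .jeq 0 0 (pre.length + K * (s.pc + 1))])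
      (h₀ : J.exec inp ρ s' = { s' with pc := if c' then pre.length + K * l else s'.pc + 1 })
      (h₁ : I.exec inp' ρ s = { s with pc := if c then l else s.pc + 1 }) :
      ∃ k ≤ K, Simulates R K pre.length x y (I.exec inp' ρ s)
        ((WordRAM.step (simProgram E (R + 2) K pre P) inp ρ)^[k] s') := by
    by_cases h : c
    · refine ⟨1, by omega, ?_⟩
      rw [hJ] at hseg
      rw [Function.iterate_one, step_eq_exec ho' hseg.head, h₀, h₁, if_pos h, if_pos (hc.1 h)]
      exact ⟨rfl, hs.reg, hs.mem, hs.rnd, hs.out, hs.fst, hs.snd⟩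
    · refine two _ J hJ h₀ ho' (by simp [hc.not.1 h]) ?_
      rw [h₁, if_neg h]
      exact ⟨rfl, hs.reg, hs.mem, hs.rnd, hs.out, hs.fst, hs.snd⟩
  cases I with
  | const d k =>
    simp only [Instr.bound] at hIR
    exact two _ _ rfl rfl ho' rfl (writes d (by omega) _)
  | op o d a b =>
    simp only [Instr.bound] at hIR
    refine two _ _ rfl rfl ho' rfl ?_
    simp only [Instr.exec, hs.reg a (by omega), hs.reg b (by omega)]
    exact writes d (by omega) _
  | load d a =>
    simp only [Instr.bound] at hIR
    refine two _ _ rfl rfl ho' rfl ?_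
    simp only [Instr.exec, hs.reg a (by omega), hs.mem]
    exact writes d (by omega) _
  | store a b =>
    simp only [Instr.bound] at hIR
    refine two _ _ rfl rfl ho' rfl ?_
    simp only [Instr.exec, hs.reg a (by omega), hs.reg b (by omega), hs.mem]
    exact ⟨rfl, hs.reg, rfl, hs.rnd, hs.out, hs.fst, hs.snd⟩
  | rand d =>
    simp only [Instr.bound] at hIR
    refine two _ _ rfl rfl ho' rfl ?_
    simp only [Instr.exec, hs.rnd]
    have := writes d (by omega) (BitVec.ofFin (ρ s.rnd))
    exact ⟨rfl, this.reg, this.mem, rfl, this.out, this.fst, this.snd⟩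
  | jlt a b l =>
    simp only [Instr.bound] at hIR
    exact jumps a b l _ _ Iff.rfl _ rfl
      (by simp only [Instr.exec, hs.reg a (by omega), hs.reg b (by omega)]) rfl
  | jeq a b l =>
    simp only [Instr.bound] at hIR
    exact jumps a b l _ _ Iff.rfl _ rfl
      (by simp only [Instr.exec, hs.reg a (by omega), hs.reg b (by omega)]) rfl
  | halt v =>
    refine ⟨1, by omega, ?_⟩
    rw [Function.iterate_one, step_eq_exec ho' hseg.head]
    exact ⟨hs.pc, hs.reg, hs.mem, hs.rnd, rfl, hs.fst, hs.snd⟩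
  | input d a b =>
    simp only [Instr.bound] at hIR
    have c := Expr.computed_code (inp := inp) (ρ := ρ) (hE.below a (by omega) b (by omega)) le_rfl
      ho' hseg.left
    have hseg' := hseg.right
    rw [Expr.length_code, ← c.pc] at hseg'
    refine ⟨1 + (1 + (E a b).size), by have := hE.size a b; omega, ?_⟩
    rw [Function.iterate_add_apply, Function.iterate_add_apply, Function.iterate_one]
    set s₁ := (WordRAM.step (simProgram E (R + 2) K pre P) inp ρ)^[(E a b).size] s'
    have hz := c.reg
    rw [hE.eval a (by omega) b (by omega) _ hs.fst hs.snd, hs.reg a (by omega),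
      hs.reg b (by omega)] at hz
    rw [step_eq_exec c.out hseg'.head, jump (by exact c.out) hseg'.tail]
    simp only [Instr.exec, BinOp.eval, hz, BitVec.or_self]
    constructor
    · rfl
    · intro i hi
      simp only [Config.write, Function.update_apply, ← hs.reg i hi, c.reg_lt i (by omega)]
    · exact c.mem.trans hs.mem
    · exact c.rnd.trans hs.rnd
    · exact c.out.trans ho.symm
    · simp only [Config.write]
      rw [Function.update_of_ne (by omega), c.reg_lt R (by omega), hs.fst]
    · simp only [Config.write]
      rw [Function.update_of_ne (by omega), c.reg_lt (R + 1) (by omega), hs.snd]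

theorem Simulates.iterate {w : ℕ} {inp inp' : ℕ → ℕ → Bool} {R K : ℕ} {x y : BitVec w}
    {E : ℕ → ℕ → Expr} (hE : Lookup inp inp' R K x y E) {pre P : Program}
    (hR : ∀ I ∈ P, I.bound ≤ R) {ρ : ℕ → Fin (2 ^ w)} {s s' : Config w}
    (hs : Simulates R K pre.length x y s s') (T : ℕ) :
    ∃ k ≤ K * T, Simulates R K pre.length x y ((WordRAM.step P inp' ρ)^[T] s)
      ((WordRAM.step (simProgram E (R + 2) K pre P) inp ρ)^[k] s') := by
  induction T with
  | zero => exact ⟨0, Nat.zero_le _, hs⟩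
  | succ T ih =>
    obtain ⟨k, hk, hsim⟩ := ih
    obtain ⟨k', hk', hsim'⟩ := hsim.step hE hR (ρ := ρ)
    refine ⟨k' + k, by rw [Nat.mul_succ]; omega, ?_⟩
    rwa [Function.iterate_succ_apply', Function.iterate_add_apply]

/-! ### Initialization, word size and running time of the simulation. -/

/-- Code that moves the first two registers to `R` and `R + 1`, multiplies the first one by `a` and
clears the second one. -/
def scaleCode (R a : ℕ) : Program :=
  [.op .or R 0 0, .op .or (R + 1) 1 1, .const 1 a, .op .mul 0 0 1, .const 1 0]

theorem simulates_init {w : ℕ} {inp : ℕ → ℕ → Bool} {R K a n m : ℕ} (hR : 2 ≤ R)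
    {E : ℕ → ℕ → Expr} {P : Program} {ρ : ℕ → Fin (2 ^ w)} :
    Simulates R K (scaleCode R a).length (BitVec.ofNat w n) (BitVec.ofNat w m)
      (Config.init w [a * n])
      ((step (simProgram E (R + 2) K (scaleCode R a) P) inp ρ)^[5] (Config.init w [n, m])) := by
  have h := segment_simProgram_pre (E := E) (R := R + 2) (K := K) (pre := scaleCode R a) (P := P)
  set P' := simProgram E (R + 2) K (scaleCode R a) P
  let s₀ := Config.init w [n, m]
  let s₁ := Instr.exec inp ρ s₀ (.op .or R 0 0)
  let s₂ := Instr.exec inp ρ s₁ (.op .or (R + 1) 1 1)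
  let s₃ := Instr.exec inp ρ s₂ (.const 1 a)
  let s₄ := Instr.exec inp ρ s₃ (.op .mul 0 0 1)
  let s₅ := Instr.exec inp ρ s₄ (.const 1 0)
  have e₁ : step P' inp ρ s₀ = s₁ := step_eq_exec rfl h.head
  have e₂ : step P' inp ρ s₁ = s₂ := step_eq_exec rfl h.tail.head
  have e₃ : step P' inp ρ s₂ = s₃ := step_eq_exec rfl h.tail.tail.head
  have e₄ : step P' inp ρ s₃ = s₄ := step_eq_exec rfl h.tail.tail.tail.head
  have e₅ : step P' inp ρ s₄ = s₅ := step_eq_exec rfl h.tail.tail.tail.tail.head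
  have e : (step P' inp ρ)^[5] s₀ = s₅ := by
    simp only [Function.iterate_succ_apply, Function.iterate_zero, id, e₁, e₂, e₃, e₄, e₅]
  rw [e]
  simp only [s₅, s₄, s₃, s₂, s₁, s₀]
  have h0 : R ≠ 0 := by omega
  have h1 : R ≠ 1 := by omega
  constructor
  · simp [Instr.exec, Config.write, Config.init, scaleCode]
  · intro i hi
    rcases i with _ | _ | i
    · simp [Instr.exec, Config.write, Config.init, BinOp.eval, h0.symm, BitVec.ofNat_mul, mul_comm]
    · simp [Instr.exec, Config.write, Config.init]
    · have : i + 1 ≠ R := by omega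
      simp [Instr.exec, Config.write, Config.init, Function.update_apply, hi.ne, this]
  · rfl
  · rfl
  · rfl
  · simp [Instr.exec, Config.write, Config.init, BinOp.eval, h0, h1]
  · simp [Instr.exec, Config.write, Config.init, BinOp.eval, h0, h0.symm, h1.symm]

theorem exists_bound (P : Program) : ∃ R, 2 ≤ R ∧ ∀ I ∈ P, I.bound ≤ R := by
  refine ⟨(P.map Instr.bound).sum + 2, by omega, fun I hI => ?_⟩
  exact (List.single_le_sum (fun _ _ => Nat.zero_le _) _ (List.mem_map_of_mem hI)).trans (by omega)

theorem Algorithm.Answers.mono {𝒜 : Algorithm} {n : ℕ} {sizes : List ℕ} {inp : ℕ → ℕ → Bool}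
    {v : Bool} {T T' : ℝ} (h : 𝒜.Answers n sizes inp v T) (hT : T ≤ T') :
    𝒜.Answers n sizes inp v T' :=
  h.trans (measure_mono fun _ hρ => run_out_mono (Nat.floor_le_floor hT) hρ)

/-- The algorithm for inputs of size parameter `n` that simulates `𝒜` on inputs of size parameter
`2 ^ p * n`. -/
def Algorithm.simulation (𝒜 : Algorithm) (E : ℕ → ℕ → Expr) (R K p : ℕ) : Algorithm where
  prog := simProgram E (R + 2) K (scaleCode R (2 ^ p)) 𝒜.prog
  c := 𝒜.c
  d := 𝒜.c * p + 𝒜.d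
  one_le_c := 𝒜.one_le_c
  one_le_d := 𝒜.one_le_d.trans (Nat.le_add_left _ _)

/-- The blow-up factor is a power of two so that the logarithm grows by exactly `p`. The two
machines then have equal word sizes, hence the same memory and the same random tape. -/
theorem Algorithm.wordSize_simulation (𝒜 : Algorithm) (E : ℕ → ℕ → Expr) (R K p : ℕ) {n : ℕ}
    (hn : n ≠ 0) : (𝒜.simulation E R K p).wordSize n = 𝒜.wordSize (2 ^ p * n) := by
  have : Nat.log 2 (2 ^ p * n) = Nat.log 2 n + p := by
    induction p with
    | zero => simp
    | succ p ih =>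
      rw [pow_succ, mul_right_comm, Nat.log_mul_base (by norm_num) (by positivity), ih, add_assoc]
  simp only [Algorithm.simulation, Algorithm.wordSize, this]
  ring

/-- Both machines consume the same random words, so each tape on which the original answers `v` in
time is one on which the simulation does; no probability is lost. The `5` steps are those of
`scaleCode`. -/
theorem Algorithm.Answers.simulation {𝒜 : Algorithm} {E : ℕ → ℕ → Expr} {R K p n m : ℕ}
    (hn : n ≠ 0) (hR2 : 2 ≤ R) (hR : ∀ I ∈ 𝒜.prog, I.bound ≤ R) {inp inp' : ℕ → ℕ → Bool}
    (hE : Lookup inp inp' R K (BitVec.ofNat (𝒜.wordSize (2 ^ p * n)) n)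
      (BitVec.ofNat (𝒜.wordSize (2 ^ p * n)) m) E) {v : Bool} {T : ℝ} (hT : 0 ≤ T)
    (h : 𝒜.Answers (2 ^ p * n) [2 ^ p * n] inp' v T) :
    (𝒜.simulation E R K p).Answers n [n, m] inp v (K * T + 5) := by
  unfold Algorithm.Answers at *
  rw [𝒜.wordSize_simulation E R K p hn]
  refine h.trans (measure_mono fun ρ hρ => ?_)
  have h₀ := simulates_init (w := 𝒜.wordSize (2 ^ p * n)) (inp := inp) (K := K) (a := 2 ^ p)
    (n := n) (m := m) hR2 (E := E) (P := 𝒜.prog) (ρ := ρ)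
  obtain ⟨k, hk, hsim⟩ := h₀.iterate hE hR (ρ := ρ) ⌊T⌋₊
  rw [← Function.iterate_add_apply] at hsim
  have hle : k + 5 ≤ ⌊K * T + 5⌋₊ := by
    refine Nat.le_floor ?_
    push_cast
    have : (k : ℝ) ≤ K * ⌊T⌋₊ := by exact_mod_cast hk
    have := mul_le_mul_of_nonneg_left (Nat.floor_le hT) (Nat.cast_nonneg (α := ℝ) K)
    linarith
  exact run_out_mono hle (hsim.out.trans hρ)

end WordRAM

/-! ## Bounds on the complexity of rectangular matrix multiplication -/

section Arithmetic

open MvPolynomial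

variable {σ τ F : Type*} [Field F]

theorem Available.append_left {g : List (MvPolynomial σ F)} {x : MvPolynomial σ F}
    (h : Available g x) (g' : List (MvPolynomial σ F)) : Available (g' ++ g) x :=
  h.imp_left fun h => List.mem_append_right _ h

theorem Available.append_right {g : List (MvPolynomial σ F)} {x : MvPolynomial σ F}
    (h : Available g x) (g' : List (MvPolynomial σ F)) : Available (g ++ g') x :=
  h.imp_left fun h => List.mem_append_left _ h

/-- Lists run from the latest operation to the earliest, so `g` is executed after `g'` and may
ignore its results. -/
theorem IsStraightLine.append {g g' : List (MvPolynomial σ F)} (h : IsStraightLine g)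
    (h' : IsStraightLine g') : IsStraightLine (g ++ g') := by
  induction h with
  | nil => exact h'
  | cons _ hx hy hz ih => exact ih.cons (hx.append_right _) (hy.append_right _) hz

theorem Available.map {g : List (MvPolynomial σ F)} {x : MvPolynomial σ F}
    {f : σ → MvPolynomial τ F} (hf : ∀ i, Available [] (f i)) (h : Available g x) :
    Available (g.map (aeval f)) (aeval f x) := by
  rcases h with h | ⟨i, rfl⟩ | ⟨a, rfl⟩
  · exact Or.inl (List.mem_map_of_mem h)
  · simpa using (hf i).append_left (g.map (aeval f))
  · exact Or.inr (Or.inr ⟨a, by simp⟩)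

theorem IsStraightLine.map {g : List (MvPolynomial σ F)} {f : σ → MvPolynomial τ F}
    (hf : ∀ i, Available [] (f i)) (h : IsStraightLine g) : IsStraightLine (g.map (aeval f)) := by
  induction h with
  | nil => exact .nil
  | cons _ hx hy hz ih =>
    refine ih.cons (hx.map hf) (hy.map hf) ?_
    rcases hz with rfl | rfl | rfl <;> simp

/-- The polynomials in `S` can be computed with at most `L` operations. -/
def CostLE (L : ℕ) (S : Set (MvPolynomial σ F)) : Prop :=
  ∃ g : List (MvPolynomial σ F), IsStraightLine g ∧ g.length ≤ L ∧ ∀ x ∈ S, Available g x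

namespace CostLE

theorem mono {L L' : ℕ} {S S' : Set (MvPolynomial σ F)} (h : CostLE L S) (hL : L ≤ L')
    (hS : S' ⊆ S) : CostLE L' S' :=
  let ⟨g, hg, hl, ha⟩ := h
  ⟨g, hg, hl.trans hL, fun x hx => ha x (hS hx)⟩

theorem union {L L' : ℕ} {S S' : Set (MvPolynomial σ F)} (h : CostLE L S)
    (h' : CostLE L' S') : CostLE (L + L') (S ∪ S') := by
  obtain ⟨g, hg, hl, ha⟩ := h
  obtain ⟨g', hg', hl', ha'⟩ := h'
  refine ⟨g ++ g', hg.append hg', by simp; omega, ?_⟩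
  rintro x (hx | hx)
  · exact (ha x hx).append_right _
  · exact (ha' x hx).append_left _

theorem map {L : ℕ} {S : Set (MvPolynomial σ F)} {f : σ → MvPolynomial τ F}
    (hf : ∀ i, Available [] (f i)) (h : CostLE L S) : CostLE L (aeval f '' S) := by
  obtain ⟨g, hg, hl, ha⟩ := h
  refine ⟨_, hg.map hf, by simpa using hl, ?_⟩
  rintro _ ⟨x, hx, rfl⟩
  exact (ha x hx).map hf

theorem empty : CostLE 0 (∅ : Set (MvPolynomial σ F)) :=
  ⟨[], .nil, le_rfl, by simp⟩

theorem biUnion {ι : Type*} {L : ℕ} (s : Finset ι) {S : ι → Set (MvPolynomial σ F)}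
    (h : ∀ i ∈ s, CostLE L (S i)) : CostLE (s.card * L) (⋃ i ∈ s, S i) := by
  classical
  induction s using Finset.induction_on with
  | empty => simpa using empty
  | insert a s ha ih =>
    refine ((h a (by simp)).union (ih fun i hi => h i (by simp [hi]))).mono ?_ ?_
    · rw [Finset.card_insert_of_notMem ha]; linarith
    · simp

theorem iUnion {ι : Type*} [Fintype ι] {L : ℕ} {S : ι → Set (MvPolynomial σ F)}
    (h : ∀ i, CostLE L (S i)) : CostLE (Fintype.card ι * L) (⋃ i, S i) := by
  simpa using biUnion Finset.univ fun i _ => h i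

theorem add {κ : Type*} [Fintype κ] {L : ℕ} {x y : κ → MvPolynomial σ F}
    (h : CostLE L (Set.range x ∪ Set.range y)) :
    CostLE (L + Fintype.card κ) (Set.range fun k => x k + y k) := by
  classical
  obtain ⟨g, hg, hl, ha⟩ := h
  have key : ∀ s : Finset κ, ∃ g' : List (MvPolynomial σ F), IsStraightLine (g' ++ g) ∧
      g'.length ≤ s.card ∧ ∀ k ∈ s, x k + y k ∈ g' := by
    intro s
    induction s using Finset.induction_on with
    | empty => exact ⟨[], hg, by simp, by simp⟩
    | insert a s has ih =>
      obtain ⟨g', hg', hl', ha'⟩ := ih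
      refine ⟨(x a + y a) :: g', hg'.cons ((ha (x a) (by simp)).append_left _)
        ((ha (y a) (by simp)).append_left _) (Or.inl rfl), ?_, ?_⟩
      · rw [Finset.card_insert_of_notMem has]; simpa using hl'
      · intro k hk
        rcases Finset.mem_insert.1 hk with rfl | hk
        · simp
        · exact List.mem_cons_of_mem _ (ha' k hk)
  obtain ⟨g', hg', hl', ha'⟩ := key Finset.univ
  refine ⟨_, hg', by simp at hl' ⊢; omega, ?_⟩
  rintro _ ⟨k, rfl⟩
  exact Or.inl (List.mem_append_left _ (ha' k (by simp)))

theorem sum {κ ι : Type*} [Fintype κ] {L : ℕ} (s : Finset ι) {x : ι → κ → MvPolynomial σ F}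
    (h : ∀ j ∈ s, CostLE L (Set.range (x j))) :
    CostLE (s.card * (L + Fintype.card κ)) (Set.range fun k => ∑ j ∈ s, x j k) := by
  classical
  induction s using Finset.induction_on with
  | empty =>
    refine ⟨[], .nil, by simp, ?_⟩
    rintro _ ⟨k, rfl⟩
    exact Or.inr (Or.inr ⟨0, by simp⟩)
  | insert a s ha ih =>
    have := ((h a (by simp)).union (ih fun i hi => h i (by simp [hi]))).add
    simp only [Finset.sum_insert ha, Finset.card_insert_of_notMem ha]
    exact this.mono (by linarith) subset_rfl

theorem mul_of_available {x y : MvPolynomial σ F} (hx : Available [] x) (hy : Available [] y) :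
    CostLE 1 {x * y} :=
  ⟨[x * y], IsStraightLine.nil.cons hx hy (Or.inr (Or.inr rfl)), le_rfl, by simp [Available]⟩

end CostLE

/-- The entries of the product of two matrices of variables. -/
noncomputable def productEntry (F : Type*) [Field F] (p q r : ℕ) (e : Fin p × Fin r) :
    MvPolynomial ((Fin p × Fin q) ⊕ (Fin q × Fin r)) F :=
  ∑ j, X (Sum.inl (e.1, j)) * X (Sum.inr (j, e.2))

theorem MM_le_of_costLE {p q r L : ℕ} (h : CostLE L (Set.range (productEntry F p q r))) :
    MM F p q r ≤ L := by
  obtain ⟨g, hg, hl, ha⟩ := h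
  exact le_trans (Nat.sInf_le ⟨g, hg, rfl, fun i k => ha _ ⟨(i, k), rfl⟩⟩) hl

theorem exists_straightLine_MM (F : Type*) [Field F] (p q r : ℕ) :
    ∃ g : List (MvPolynomial ((Fin p × Fin q) ⊕ (Fin q × Fin r)) F),
      IsStraightLine g ∧ g.length = MM F p q r ∧ ∀ e, Available g (productEntry F p q r e) := by
  -- The schoolbook algorithm shows that some program exists; otherwise the infimum would be the
  -- junk value `0`.
  have hne : {L | ∃ g : List (MvPolynomial ((Fin p × Fin q) ⊕ (Fin q × Fin r)) F),
      IsStraightLine g ∧ g.length = L ∧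
      ∀ i k, Available g (∑ j, X (Sum.inl (i, j)) * X (Sum.inr (j, k)))}.Nonempty := by
    have h := CostLE.sum (κ := Fin p × Fin r) (Finset.univ : Finset (Fin q))
      (x := fun j e => (X (Sum.inl (e.1, j)) * X (Sum.inr (j, e.2)) :
        MvPolynomial ((Fin p × Fin q) ⊕ (Fin q × Fin r)) F)) fun j _ =>
      (CostLE.iUnion fun e => CostLE.mul_of_available (Or.inr (Or.inl ⟨_, rfl⟩))
        (Or.inr (Or.inl ⟨_, rfl⟩))).mono le_rfl (by
          rintro _ ⟨e, rfl⟩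
          exact Set.mem_iUnion.2 ⟨e, rfl⟩)
    obtain ⟨g, hg, -, ha⟩ := h
    exact ⟨_, g, hg, rfl, fun i k => ha _ ⟨(i, k), rfl⟩⟩
  obtain ⟨g, hg, hl, ha⟩ := Nat.sInf_mem hne
  exact ⟨g, hg, hl, fun e => ha e.1 e.2⟩

theorem costLE_MM (F : Type*) [Field F] (p q r : ℕ) :
    CostLE (MM F p q r) (Set.range (productEntry F p q r)) := by
  obtain ⟨g, hg, hl, ha⟩ := exists_straightLine_MM F p q r
  refine ⟨g, hg, hl.le, ?_⟩
  rintro _ ⟨e, rfl⟩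
  exact ha e

/-- The entries of the product are `p * r` distinct polynomials, none of them a variable or a
constant, so each must occur in the program. Pairs of unit matrices (`pt`) tell them apart. At a
point with a single nonzero coordinate all entries vanish by bilinearity, which excludes variables
and, combined with `pt`, constants. -/
theorem le_MM (F : Type*) [Field F] (p q r : ℕ) (hq : q ≠ 0) : p * r ≤ MM F p q r := by
  classical
  obtain ⟨g, hg, hl, ha⟩ := exists_straightLine_MM F p q r
  let j₀ : Fin q := ⟨0, Nat.pos_of_ne_zero hq⟩
  let pt (e : Fin p × Fin r) : (Fin p × Fin q) ⊕ (Fin q × Fin r) → F :=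
    Sum.elim (fun x => if x = (e.1, j₀) then 1 else 0) (fun x => if x = (j₀, e.2) then 1 else 0)
  have hpt (e e' : Fin p × Fin r) : MvPolynomial.eval (pt e) (productEntry F p q r e') =
      if e' = e then 1 else 0 := by
    simp only [productEntry, map_sum, map_mul, eval_X, pt, Sum.elim_inl, Sum.elim_inr]
    rw [Finset.sum_eq_single j₀]
    · simp only [Prod.ext_iff, and_true, true_and]
      split_ifs <;> simp_all
    · intro j _ hj
      simp [hj]
    · simp
  have h0 (i) (e : Fin p × Fin r) :
      MvPolynomial.eval (Pi.single i 1) (productEntry F p q r e) = 0 := by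
    simp only [productEntry, map_sum, map_mul, eval_X]
    refine Finset.sum_eq_zero fun j _ => ?_
    rcases i with i | i <;> simp [Pi.single_apply]
  have hinj : Function.Injective (productEntry F p q r) := by
    intro e e' h
    have h₁ := hpt e e'
    rw [← h, hpt e e, if_pos rfl] at h₁
    by_contra hne
    rw [if_neg (Ne.symm hne)] at h₁
    exact one_ne_zero h₁
  have hmem (e) : productEntry F p q r e ∈ g := by
    rcases ha e with h | ⟨i, h⟩ | ⟨a, h⟩
    · exact h
    · have := h0 i e
      rw [h] at this
      simp at this
    · have h₁ := h0 (Sum.inl (e.1, j₀)) e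
      have h₂ := hpt e e
      rw [h] at h₁ h₂
      simp only [eval_C] at h₁ h₂
      simp [h₁] at h₂
  calc p * r = (Finset.univ.image (productEntry F p q r)).card := by
        rw [Finset.card_image_of_injective _ hinj]; simp
    _ ≤ g.toFinset.card := Finset.card_le_card fun x hx => by
        obtain ⟨e, -, rfl⟩ := Finset.mem_image.1 hx
        exact List.mem_toFinset.2 (hmem e)
    _ ≤ g.length := List.toFinset_card_le g
    _ = MM F p q r := hl

/-- Cut the outer dimensions into `a` and `b` pieces and the inner one into `⌈q / m⌉` slices, the
last padded with zeros. Every slice costs `a * b` small products and one addition per entry;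
substituting variables or zeros is free. -/
theorem MM_blocks_le (F : Type*) [Field F] (a b p q r m : ℕ) (hm : m ≠ 0) :
    MM F (a * p) q (b * r) ≤
      (q ⌈/⌉ m) * (a * b * MM F p m r + a * p * (b * r)) := by
  classical
  let Q := q ⌈/⌉ m
  let f (e : Fin (a * p) × Fin (b * r)) (j : ℕ) :
      MvPolynomial ((Fin (a * p) × Fin q) ⊕ (Fin q × Fin (b * r))) F :=
    if hj : j < q then X (Sum.inl (e.1, ⟨j, hj⟩)) * X (Sum.inr (⟨j, hj⟩, e.2)) else 0
  let x (J : ℕ) (e : Fin (a * p) × Fin (b * r)) := ∑ j ∈ Finset.range m, f e (m * J + j)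
  have hx (J : ℕ) : CostLE (a * b * MM F p m r) (Set.range (x J)) := by
    let φ (d : Fin a × Fin b) : (Fin p × Fin m) ⊕ (Fin m × Fin r) →
        MvPolynomial ((Fin (a * p) × Fin q) ⊕ (Fin q × Fin (b * r))) F :=
      Sum.elim
        (fun y => if hj : m * J + y.2 < q then
          X (Sum.inl (finProdFinEquiv (d.1, y.1), ⟨m * J + y.2, hj⟩)) else 0)
        (fun y => if hj : m * J + y.1 < q then
          X (Sum.inr (⟨m * J + y.1, hj⟩, finProdFinEquiv (d.2, y.2))) else 0)
    have hφ (d i) : Available [] (φ d i) := by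
      rcases i with i | i
      all_goals
        simp only [φ, Sum.elim_inl, Sum.elim_inr]
        split_ifs
        · exact Or.inr (Or.inl ⟨_, rfl⟩)
        · exact Or.inr (Or.inr ⟨0, by simp⟩)
    refine (CostLE.iUnion fun d => (costLE_MM F p m r).map (hφ d)).mono (by simp) ?_
    rintro _ ⟨⟨i, k⟩, rfl⟩
    obtain ⟨⟨i₁, i₂⟩, rfl⟩ := finProdFinEquiv.surjective i
    obtain ⟨⟨k₁, k₂⟩, rfl⟩ := finProdFinEquiv.surjective k
    refine Set.mem_iUnion.2 ⟨(i₁, k₁), _, ⟨(i₂, k₂), rfl⟩, ?_⟩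
    simp only [productEntry, map_sum, map_mul, aeval_X, x, f, φ, Sum.elim_inl, Sum.elim_inr]
    rw [Finset.sum_range]
    refine Finset.sum_congr rfl fun j _ => ?_
    split_ifs <;> simp
  have hsum (e) : productEntry F (a * p) q (b * r) e = ∑ J ∈ Finset.range Q, x J e := by
    have h₁ : ∀ K, ∑ J ∈ Finset.range K, x J e = ∑ j ∈ Finset.range (m * K), f e j := by
      intro K
      induction K with
      | zero => simp
      | succ K ih => rw [Finset.sum_range_succ, ih, Nat.mul_succ, Finset.sum_range_add]
    have hQ : q ≤ m * Q := by
      simpa using le_smul_ceilDiv (β := ℕ) (a := m) (b := q) (Nat.pos_of_ne_zero hm)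
    rw [h₁, ← Finset.sum_subset (Finset.range_mono hQ), Finset.sum_range]
    · simp [productEntry, f]
    · intro j _ hj
      simp [f, Finset.mem_range.not.1 hj]
  refine MM_le_of_costLE ?_
  have := CostLE.sum (Finset.range Q) fun J _ => hx J
  simp only [← hsum] at this
  simpa using this

end Arithmetic

/-! ## Blow-ups of tripartite graphs -/

/-- The arcs of the blow-up of a tripartite graph with adjacency matrix `inp` and parts of sizes
`N`, `m`, `N`. The vertex `u` lies in layer `u / L`. The layers `0` and `H + 1` consist of copies of
the vertices of the first and the last part, the layers in between of copies of the vertices of the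
middle part. -/
def BlowUpArc (inp : ℕ → ℕ → Bool) (N m H L u v : ℕ) : Prop :=
  (u / L = 0 ∧ v / L = 1 ∧ inp (u % N) (N + v % m)) ∨
  (u / L = H ∧ v / L = H + 1 ∧ inp (N + u % m) (N + m + v % N)) ∨
  (u / L = H + 1 ∧ v / L = 0 ∧ inp (N + m + u % N) (v % N)) ∨
  (u / L ≠ 0 ∧ v / L = u / L + 1 ∧ v / L ≤ H ∧ u % m = v % m)

/-- Vertices `x`, `y`, `z` of the three parts that form a triangle. -/
def TripartiteTriangle (inp : ℕ → ℕ → Bool) (N m x y z : ℕ) : Prop :=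
  x < N ∧ y < m ∧ z < N ∧ inp x (N + y) ∧ inp (N + y) (N + m + z) ∧ inp (N + m + z) x

section BlowUp

variable {inp : ℕ → ℕ → Bool} {N m H L : ℕ}

theorem BlowUpArc.layer {u v : ℕ} (hH : 1 ≤ H) (h : BlowUpArc inp N m H L u v) :
    (v / L = u / L + 1 ∧ v / L ≤ H + 1) ∨ (u / L = H + 1 ∧ v / L = 0) := by
  unfold BlowUpArc at h
  omega

theorem BlowUpArc.layer_le {u v : ℕ} (hH : 1 ≤ H) (h : BlowUpArc inp N m H L u v) :
    u / L ≤ H + 1 ∧ v / L ≤ H + 1 := by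
  have := h.layer hH
  omega

theorem BlowUpArc.irrefl (hH : 1 ≤ H) (u : ℕ) : ¬ BlowUpArc inp N m H L u u := fun h => by
  have := h.layer hH
  omega

theorem BlowUpArc.cast_layer {u v : ℕ} (hH : 1 ≤ H) (h : BlowUpArc inp N m H L u v) :
    ((v / L : ℕ) : ZMod (H + 2)) = (u / L : ℕ) + 1 := by
  rcases h.layer hH with ⟨h, -⟩ | ⟨h, h'⟩
  · rw [h]; push_cast; rfl
  · rw [h, h']
    have := ZMod.natCast_self (H + 2)
    push_cast at this ⊢
    rw [← this]; ring

/-! ### From cycles of the blow-up to triangles. -/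

/-- Start the walk at a visit to layer `0`. It climbs through all layers with the residue modulo `m`
constant on the middle ones, and by periodicity the last arc closes up at the starting vertex. -/
theorem exists_triangle_of_periodic (hH : 1 ≤ H) (hN : 0 < N) (hm : 0 < m) {f : ℕ → ℕ}
    (hf : ∀ j, BlowUpArc inp N m H L (f j) (f (j + 1))) (hp : ∀ j, f (j + (H + 2)) = f j) :
    ∃ x y z, TripartiteTriangle inp N m x y z := by
  obtain ⟨i, hi⟩ : ∃ i, f i / L = 0 := by
    have key : ∀ j, f 0 / L + j ≤ H + 1 → f j / L = f 0 / L + j := by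
      intro j
      induction j with
      | zero => simp
      | succ j ih =>
        intro hj
        have h₁ := ih (by omega)
        have h₂ := (hf j).layer hH
        omega
    have h₀ := ((hf 0).layer_le hH).1
    refine ⟨H + 1 - f 0 / L + 1, ?_⟩
    have h₁ := key (H + 1 - f 0 / L) (by omega)
    have h₂ := (hf (H + 1 - f 0 / L)).layer hH
    omega
  have layer : ∀ j ≤ H + 1, f (i + j) / L = j := by
    intro j
    induction j with
    | zero => simpa using hi
    | succ j ih =>
      intro hj
      have h₁ := ih (by omega)
      have h₂ := (hf (i + j)).layer hH
      rw [add_assoc] at h₂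
      omega
  have mid : ∀ j, j + 1 ≤ H → f (i + (j + 1)) % m = f (i + 1) % m := by
    intro j
    induction j with
    | zero => simp
    | succ j ih =>
      intro hj
      have h₁ := layer (j + 1) (by omega)
      have h₂ := layer (j + 1 + 1) (by omega)
      have h₃ := hf (i + (j + 1))
      rw [← ih (by omega)]
      unfold BlowUpArc at h₃
      rw [add_assoc, h₁, h₂] at h₃
      omega
  have h₀ := hf i
  have h₁ := hf (i + H)
  have h₂ := hf (i + (H + 1))
  have l₁ := layer 1 (by omega)
  have l₂ := layer H (by omega)
  have l₃ := layer (H + 1) (by omega)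
  have hmid := mid (H - 1) (by omega)
  rw [Nat.sub_add_cancel hH] at hmid
  rw [add_assoc] at h₁
  rw [show i + (H + 1) + 1 = i + (H + 2) by omega, hp i] at h₂
  unfold BlowUpArc at h₀ h₁ h₂
  rw [hi, l₁] at h₀
  rw [l₂, l₃, hmid] at h₁
  rw [l₃, hi] at h₂
  refine ⟨f i % N, f (i + 1) % m, f (i + (H + 1)) % N, Nat.mod_lt _ hN, Nat.mod_lt _ hm,
    Nat.mod_lt _ hN, ?_, ?_, ?_⟩
  · rcases h₀ with h | h | h | h
    · exact h.2.2
    all_goals omega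
  · rcases h₁ with h | h | h | h
    · omega
    · exact h.2.2
    all_goals omega
  · rcases h₂ with h | h | h | h
    · omega
    · omega
    · exact h.2.2
    · omega

theorem exists_triangle_of_cycle (hH : 1 ≤ H) (hN : 0 < N) (hm : 0 < m) {f : ZMod (H + 2) → ℕ}
    (hf : ∀ i, BlowUpArc inp N m H L (f i) (f (i + 1))) :
    ∃ x y z, TripartiteTriangle inp N m x y z := by
  refine exists_triangle_of_periodic (L := L) hH hN hm (f := fun j => f j) (fun j => ?_) fun j => ?_
  · simpa using hf j
  · have := ZMod.natCast_self (H + 2)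
    simp only [Nat.cast_add] at this ⊢
    rw [this, add_zero]

/-- Let `ε i = ±1` be the direction of the `i`-th edge. The layers return to their start, so `H + 2`
divides `∑ ε i`, whose absolute value is at most `H + 2`. As a sum of an odd number of signs it is
odd, hence equal to `±(H + 2)`, and all edges point the same way round. -/
theorem exists_triangle_of_odd_cycle (hH : 1 ≤ H) (hodd : Odd (H + 2)) (hN : 0 < N) (hm : 0 < m)
    {f : ZMod (H + 2) → ℕ} (hf : ∀ i, BlowUpArc inp N m H L (f i) (f (i + 1)) ∨
      BlowUpArc inp N m H L (f (i + 1)) (f i)) :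
    ∃ x y z, TripartiteTriangle inp N m x y z := by
  classical
  let ε (i : ZMod (H + 2)) : ℤ := if BlowUpArc inp N m H L (f i) (f (i + 1)) then 1 else -1
  have hε (i) : ((f (i + 1) / L : ℕ) : ZMod (H + 2)) = (f i / L : ℕ) + (ε i : ℤ) := by
    by_cases h : BlowUpArc inp N m H L (f i) (f (i + 1))
    · simp [ε, h, h.cast_layer hH]
    · simp [ε, h, ((hf i).resolve_left h).cast_layer hH]
  have hsum : ((∑ i, ε i : ℤ) : ZMod (H + 2)) = 0 := by
    have h₁ : ∑ i : ZMod (H + 2), ((f (i + 1) / L : ℕ) : ZMod (H + 2)) =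
        ∑ i : ZMod (H + 2), ((f i / L : ℕ) : ZMod (H + 2)) :=
      Equiv.sum_comp (Equiv.addRight (1 : ZMod (H + 2)))
        fun i => ((f i / L : ℕ) : ZMod (H + 2))
    simp only [hε, Finset.sum_add_distrib] at h₁
    push_cast
    simpa using h₁
  rw [ZMod.intCast_zmod_eq_zero_iff_dvd] at hsum
  have hcard : ∑ _i : ZMod (H + 2), (1 : ℤ) = (H + 2 : ℕ) := by simp [ZMod.card]
  have hle (i) : ε i ≤ 1 := by simp only [ε]; split_ifs <;> norm_num
  have hge (i) : -1 ≤ ε i := by simp only [ε]; split_ifs <;> norm_num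
  have hub : ∑ i, ε i ≤ (H + 2 : ℕ) := hcard ▸ Finset.sum_le_sum fun i _ => hle i
  have hlb : -((H + 2 : ℕ) : ℤ) ≤ ∑ i, ε i := by
    rw [← hcard, ← Finset.sum_neg_distrib]
    exact Finset.sum_le_sum fun i _ => hge i
  have hpar : (2 : ℤ) ∣ ∑ i, ε i - (H + 2 : ℕ) := by
    rw [← hcard, ← Finset.sum_sub_distrib]
    refine Finset.dvd_sum fun i _ => ?_
    simp only [ε]; split_ifs <;> norm_num
  have hcases : ∑ i, ε i = (H + 2 : ℕ) ∨ ∑ i, ε i = -((H + 2 : ℕ) : ℤ) := by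
    obtain ⟨k, hk⟩ := hsum
    obtain ⟨l, hl⟩ := hodd
    have hpos : (0 : ℤ) < (H + 2 : ℕ) := by positivity
    have hk1 : k ≤ 1 := by
      by_contra h
      nlinarith
    have hk2 : -1 ≤ k := by
      by_contra h
      nlinarith
    have : k = 1 ∨ k = 0 ∨ k = -1 := by omega
    rcases this with rfl | rfl | rfl
    · left; simpa using hk
    · exfalso; omega
    · right; simpa using hk
  rcases hcases with h | h
  · rw [← hcard, Finset.sum_eq_sum_iff_of_le fun i _ => hle i] at h
    refine exists_triangle_of_cycle (L := L) hH hN hm (f := f) fun i => ?_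
    by_contra hi
    have := h i (Finset.mem_univ i)
    simp [ε, hi] at this
  · rw [← hcard, ← Finset.sum_neg_distrib, eq_comm,
      Finset.sum_eq_sum_iff_of_le fun i _ => hge i] at h
    -- All edges point backwards, so the reversed cycle follows the arcs.
    refine exists_triangle_of_cycle (L := L) hH hN hm (f := fun i => f (-i)) fun i => ?_
    have h₁ := hf (-(i + 1))
    rw [show -(i + 1) + 1 = -i by ring] at h₁
    refine h₁.resolve_left fun hi => ?_
    have := h (-(i + 1)) (Finset.mem_univ _)
    simp only [ε] at this
    rw [show -(i + 1) + 1 = -i by ring, if_pos hi] at this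
    norm_num at this

/-! ### From a triangle to many cycles of the blow-up. -/

theorem val_add_one_eq {k : ℕ} (i : Fin (k + 2)) :
    (i + 1).val = if i.val = k + 1 then 0 else i.val + 1 := by
  simp only [Fin.val_add_one, Fin.ext_iff, Fin.val_last]

theorem cycleGraph_adj_iff {k : ℕ} {i j : Fin (k + 2)} :
    (SimpleGraph.cycleGraph (k + 2)).Adj i j ↔ i = j + 1 ∨ j = i + 1 := by
  rw [SimpleGraph.cycleGraph_adj, sub_eq_iff_eq_add', sub_eq_iff_eq_add']

/-- The vertices of the layer `i` of the blow-up that are copies of a vertex of the triangle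
`x`, `y`, `z`. -/
def copies (n N m H L x y z : ℕ) (i : ℕ) : Finset (Fin n) :=
  Finset.univ.filter fun v => v.val / L = i ∧
    if i = 0 then v.val % N = x else if i = H + 1 then v.val % N = z else v.val % m = y

theorem blowUpArc_of_mem_copies {n x y z : ℕ} (hH : 1 ≤ H)
    (ht : TripartiteTriangle inp N m x y z) {f : ZMod (H + 2) → Fin n}
    (hf : ∀ i, f i ∈ copies n N m H L x y z i.val) (i : ZMod (H + 2)) :
    BlowUpArc inp N m H L (f i) (f (i + 1)) := by
  have h₁ := hf i
  have h₂ := hf (i + 1)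
  have hi := ZMod.val_lt i
  have hval : (i + 1).val = if i.val = H + 1 then 0 else i.val + 1 := by
    exact val_add_one_eq i
  rw [hval] at h₂
  simp only [copies, Finset.mem_filter, Finset.mem_univ, true_and] at h₁ h₂
  obtain ⟨-, -, -, hxy, hyz, hzx⟩ := ht
  unfold BlowUpArc
  by_cases h0 : i.val = 0
  · rw [if_pos h0] at h₁
    rw [if_neg (by omega)] at h₂
    rw [if_neg (by omega), if_neg (by omega)] at h₂
    left
    rw [h₁.2, h₂.2]
    exact ⟨by omega, by omega, hxy⟩
  rw [if_neg h0] at h₁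
  by_cases h1 : i.val = H + 1
  · rw [if_pos h1] at h₁
    rw [if_pos h1] at h₂
    simp only [if_true] at h₂
    right; right; left
    rw [h₁.2, h₂.2]
    exact ⟨by omega, by omega, hzx⟩
  rw [if_neg h1] at h₁ h₂
  rw [if_neg (by omega)] at h₂
  by_cases h2 : i.val = H
  · rw [if_pos (by omega)] at h₂
    right; left
    rw [h₁.2, h₂.2]
    exact ⟨by omega, by omega, hyz⟩
  · rw [if_neg (by omega)] at h₂
    right; right; right
    omega

/-- A layer is an interval of `L` consecutive integers, and each residue class modulo `r` occurs in
it at least `⌊L / r⌋` times. The offset `c` is the first occurrence. -/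
theorem le_card_filter_mod {n r x i : ℕ} (hx : x < r) (hn : (i + 1) * L ≤ n) :
    L / r ≤ (Finset.univ.filter fun v : Fin n => v.val / L = i ∧ v.val % r = x).card := by
  obtain ⟨c, hc, hcx⟩ : ∃ c < r, (i * L + c) % r = x := by
    refine ⟨(x + (r - i * L % r)) % r, Nat.mod_lt _ (by omega), ?_⟩
    have h₁ := Nat.mod_add_div (i * L) r
    have h₂ := Nat.mod_lt (i * L) (by omega : 0 < r)
    rw [Nat.add_mod_mod]
    have : i * L + (x + (r - i * L % r)) = x + r * (i * L / r + 1) := by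
      rw [Nat.mul_succ]; omega
    rw [this, Nat.add_mul_mod_self_left, Nat.mod_eq_of_lt hx]
  have hlt (j : Fin (L / r)) : c + r * j < L :=
    calc c + r * j < r * (j + 1) := by rw [Nat.mul_succ]; omega
      _ ≤ r * (L / r) := Nat.mul_le_mul_left r j.2
      _ ≤ L := Nat.mul_div_le L r
  have hlt' (j : Fin (L / r)) : i * L + (c + r * j) < n := by
    have := hlt j
    rw [Nat.succ_mul] at hn
    omega
  calc L / r = (Finset.univ.image fun j : Fin (L / r) =>
        (⟨i * L + (c + r * j), hlt' j⟩ : Fin n)).card := by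
        rw [Finset.card_image_of_injective, Finset.card_univ, Fintype.card_fin]
        intro j j' h
        simp only [Fin.mk.injEq, add_right_inj] at h
        exact Fin.ext (Nat.eq_of_mul_eq_mul_left (by omega) h)
    _ ≤ _ := Finset.card_le_card fun v hv => by
        obtain ⟨j, -, rfl⟩ := Finset.mem_image.1 hv
        have := hlt j
        simp only [Finset.mem_filter, Finset.mem_univ, true_and]
        constructor
        · rw [mul_comm, Nat.mul_add_div (by omega), Nat.div_eq_of_lt this, add_zero]
        · rw [← add_assoc, Nat.add_mul_mod_self_left, hcx]

theorem le_prod_card_copies {n x y z e : ℕ} (hx : x < N) (hy : y < m) (hz : z < N)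
    (hL : L = e * N) (hn : (H + 2) * L ≤ n) :
    e * e * (L / m) ^ H ≤ ∏ i : ZMod (H + 2), (copies n N m H L x y z i.val).card := by
  have hLN : L / N = e := by rw [hL, Nat.mul_div_cancel _ (by omega)]
  have hi (i : ℕ) (hi : i < H + 2) : (i + 1) * L ≤ n :=
    (Nat.mul_le_mul_right L hi).trans hn
  have h₀ : e ≤ (copies n N m H L x y z 0).card := by
    simpa [copies, hLN] using le_card_filter_mod hx (hi 0 (by omega))
  have h₁ : e ≤ (copies n N m H L x y z (H + 1)).card := by
    simpa [copies, hLN] using le_card_filter_mod hz (hi (H + 1) (by omega))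
  have h₂ (i : ℕ) (hiH : i < H) : L / m ≤ (copies n N m H L x y z (i + 1)).card := by
    simpa [copies, hiH.ne] using le_card_filter_mod hy (hi (i + 1) (by omega))
  -- `ZMod (H + 2)` unfolds to `Fin (H + 2)`, so the first and the last factor can be split off.
  change _ ≤ ∏ i : Fin (H + 2), (copies n N m H L x y z i.val).card
  rw [Fin.prod_univ_succ, Fin.prod_univ_castSucc]
  simp only [Fin.val_zero, Fin.val_succ, Fin.val_castSucc, Fin.val_last]
  have h₃ : (L / m) ^ H ≤ ∏ i : Fin H, (copies n N m H L x y z (i.val + 1)).card := by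
    have := Finset.prod_le_prod' (s := (Finset.univ : Finset (Fin H))) fun i _ => h₂ i.val i.2
    simpa using this
  calc e * e * (L / m) ^ H = e * ((L / m) ^ H * e) := by ring
    _ ≤ _ := Nat.mul_le_mul h₀ (Nat.mul_le_mul h₃ h₁)

/-- The directed blow-up. -/
def blowUpDigraph (inp : ℕ → ℕ → Bool) (n N m H L : ℕ) : Digraph (Fin n) where
  Adj u v := BlowUpArc inp N m H L u v

/-- The undirected blow-up. -/
def blowUpGraph (inp : ℕ → ℕ → Bool) (n N m H L : ℕ) (hH : 1 ≤ H) : SimpleGraph (Fin n) where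
  Adj u v := BlowUpArc inp N m H L u v ∨ BlowUpArc inp N m H L v u
  symm := ⟨fun _ _ h => h.symm⟩
  loopless := ⟨fun _ h => h.elim (BlowUpArc.irrefl hH _) (BlowUpArc.irrefl hH _)⟩

theorem layer_of_mem_copies {n x y z i : ℕ} {v : Fin n} (h : v ∈ copies n N m H L x y z i) :
    v.val / L = i := by
  simp only [copies, Finset.mem_filter] at h
  exact h.2.1

theorem eq_of_mem_copies {n x y z : ℕ} {f f' : ZMod (H + 2) → Fin n}
    (hf : ∀ i, f i ∈ copies n N m H L x y z i.val) (hf' : ∀ i, f' i ∈ copies n N m H L x y z i.val)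
    {i j : ZMod (H + 2)} (h : f i = f' j) : i = j := by
  have h₁ := layer_of_mem_copies (hf i)
  rw [h, layer_of_mem_copies (hf' j)] at h₁
  exact (ZMod.val_injective _ h₁).symm

/-- The layer of a vertex reveals its index. A choice of copies is thus determined by its vertex
set, and different choices give different subgraphs, not rotations of one another. -/
theorem eq_of_range_subset {n x y z : ℕ} {f f' : ZMod (H + 2) → Fin n}
    (hf : ∀ i, f i ∈ copies n N m H L x y z i.val) (hf' : ∀ i, f' i ∈ copies n N m H L x y z i.val)
    (h : Set.range f ⊆ Set.range f') : f = f' := by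
  funext i
  obtain ⟨j, hj⟩ := h ⟨i, rfl⟩
  rw [← hj, eq_of_mem_copies hf hf' hj.symm]

theorem blowUpDigraph_cycleCount_eq_zero {n : ℕ} (hH : 1 ≤ H) (hN : 0 < N) (hm : 0 < m)
    (h : ¬ ∃ x y z, TripartiteTriangle inp N m x y z) :
    (blowUpDigraph inp n N m H L).cycleCount (H + 2) = 0 := by
  rw [Digraph.cycleCount, Set.ncard_eq_zero (Set.toFinite _), Set.eq_empty_iff_forall_notMem]
  rintro E ⟨f, -, hf, -⟩
  exact h (exists_triangle_of_cycle (L := L) hH hN hm (f := fun i => (f i).val) hf)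

theorem le_blowUpDigraph_cycleCount {n x y z e : ℕ} (hH : 1 ≤ H)
    (ht : TripartiteTriangle inp N m x y z) (hL : L = e * N) (hn : (H + 2) * L ≤ n) :
    e * e * (L / m) ^ H ≤ (blowUpDigraph inp n N m H L).cycleCount (H + 2) := by
  classical
  refine (le_prod_card_copies ht.1 ht.2.1 ht.2.2.1 hL hn).trans ?_
  rw [← Fintype.card_piFinset, ← Set.ncard_coe_finset]
  refine Set.ncard_le_ncard_of_injOn (fun f => Set.range fun i => (f i, f (i + 1))) ?_ ?_
    (Set.toFinite _)
  · intro f hf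
    rw [Finset.mem_coe, Fintype.mem_piFinset] at hf
    exact ⟨f, fun i j hij => eq_of_mem_copies hf hf hij, blowUpArc_of_mem_copies hH ht hf, rfl⟩
  · intro f hf f' hf' h
    rw [Finset.mem_coe, Fintype.mem_piFinset] at hf hf'
    refine eq_of_range_subset hf hf' ?_
    rintro _ ⟨i, rfl⟩
    obtain ⟨j, hj⟩ := h.le ⟨i, rfl⟩
    exact ⟨j, congrArg Prod.fst hj⟩

theorem blowUpGraph_copyCount_eq_zero {n : ℕ} (hH : 1 ≤ H) (hodd : Odd (H + 2)) (hN : 0 < N)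
    (hm : 0 < m) (h : ¬ ∃ x y z, TripartiteTriangle inp N m x y z) :
    (blowUpGraph inp n N m H L hH).copyCount (SimpleGraph.cycleGraph (H + 2)) = 0 := by
  rw [SimpleGraph.copyCount_eq_zero]
  rintro ⟨f⟩
  refine h (exists_triangle_of_odd_cycle (L := L) hH hodd hN hm
    (f := fun i : Fin (H + 2) => (f i).val) fun i => ?_)
  exact f.toHom.map_adj (cycleGraph_adj_iff.2 (Or.inr rfl))

theorem le_blowUpGraph_copyCount {n x y z e : ℕ} (hH : 1 ≤ H)
    (ht : TripartiteTriangle inp N m x y z) (hL : L = e * N) (hn : (H + 2) * L ≤ n) :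
    e * e * (L / m) ^ H ≤
      (blowUpGraph inp n N m H L hH).copyCount (SimpleGraph.cycleGraph (H + 2)) := by
  classical
  refine (le_prod_card_copies ht.1 ht.2.1 ht.2.2.1 hL hn).trans ?_
  rw [← Fintype.card_piFinset, SimpleGraph.copyCount_eq_card_image_copyToSubgraph]
  let S := Fintype.piFinset fun i : ZMod (H + 2) => copies n N m H L x y z i.val
  have hS (f : S) : ∀ i, f.1 i ∈ copies n N m H L x y z i.val := Fintype.mem_piFinset.1 f.2
  let φ (f : S) : (SimpleGraph.cycleGraph (H + 2)).Copy (blowUpGraph inp n N m H L hH) :=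
    ⟨⟨f.1, by
      intro i j hij
      rcases cycleGraph_adj_iff.1 hij with rfl | rfl
      · exact Or.inr (blowUpArc_of_mem_copies hH ht (hS f) j)
      · exact Or.inl (blowUpArc_of_mem_copies hH ht (hS f) i)⟩,
      fun i j hij => eq_of_mem_copies (hS f) (hS f) hij⟩
  have hφ : Function.Injective fun f : S => (φ f).toSubgraph := by
    intro f f' h
    have := congrArg SimpleGraph.Subgraph.verts h
    simp only [SimpleGraph.Copy.toSubgraph, SimpleGraph.Subgraph.map_verts,
      SimpleGraph.Subgraph.verts_top, Set.image_univ] at this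
    exact Subtype.ext (eq_of_range_subset (hS f) (hS f') this.le)
  calc S.card = (Finset.univ.image fun f : S => (φ f).toSubgraph).card := by
        rw [Finset.card_image_of_injective _ hφ]; simp
    _ ≤ _ := Finset.card_le_card fun G hG => by
        obtain ⟨f, -, rfl⟩ := Finset.mem_image.1 hG
        exact Finset.mem_image_of_mem _ (Finset.mem_univ _)

end BlowUp

/-! ## The reduction -/

namespace WordRAM

/-- The word `x` is `1` if `p` holds and `0` otherwise. -/
def Indicates {w : ℕ} (x : BitVec w) (p : Prop) : Prop :=
  (p → x = BitVec.ofNat w 1) ∧ (¬ p → x = 0)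

namespace Indicates

variable {w : ℕ} {x y : BitVec w} {p q : Prop}

theorem ite (b : Bool) : Indicates (if b then BitVec.ofNat w 1 else 0) (b = true) := by
  cases b <;> simp [Indicates]

theorem congr (h : Indicates x p) (hpq : p ↔ q) : Indicates x q := by
  rwa [← propext hpq]

theorem eq_ite (h : Indicates x p) {b : Bool} (hb : b = true ↔ p) :
    x = if b then BitVec.ofNat w 1 else 0 := by
  cases b
  · simpa using h.2 fun hp => by simpa using hb.2 hp
  · simpa using h.1 (hb.1 rfl)

theorem and (hx : Indicates x p) (hy : Indicates y q) : Indicates (x &&& y) (p ∧ q) := by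
  by_cases hp : p <;> by_cases hq : q <;>
    simp_all [Indicates]

theorem or (hx : Indicates x p) (hy : Indicates y q) : Indicates (x ||| y) (p ∨ q) := by
  by_cases hp : p <;> by_cases hq : q <;>
    simp_all [Indicates]

theorem not (hx : Indicates x p) : Indicates (x ^^^ BitVec.ofNat w 1) (¬ p) := by
  by_cases hp : p <;> simp_all [Indicates]

/-- If the exclusive or is `0` the quotient is `1 / 1`; otherwise the denominator exceeds `1`, or it
wraps around to `0` and division by zero gives `0`. -/
theorem eq (hw : w ≠ 0) (x y : BitVec w) :
    Indicates (BitVec.ofNat w 1 / ((x ^^^ y) + BitVec.ofNat w 1)) (x.toNat = y.toNat) := by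
  have h2 : 1 < 2 ^ w := Nat.one_lt_two_pow hw
  constructor
  · intro h
    rw [BitVec.eq_of_toNat_eq h]
    apply BitVec.eq_of_toNat_eq
    simp [Nat.mod_eq_of_lt h2, hw]
  · intro h
    have hz : (x ^^^ y).toNat ≠ 0 := by
      intro h0
      apply h
      have : x ^^^ y = 0 := BitVec.eq_of_toNat_eq h0
      rw [BitVec.xor_eq_zero_iff.1 this]
    apply BitVec.eq_of_toNat_eq
    rw [BitVec.toNat_udiv, BitVec.toNat_add, BitVec.toNat_ofNat, Nat.mod_eq_of_lt h2]
    have hlt := (x ^^^ y).isLt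
    rcases Nat.lt_or_ge ((x ^^^ y).toNat + 1) (2 ^ w) with hl | hl
    · rw [Nat.mod_eq_of_lt hl, Nat.div_eq_of_lt (by omega)]
      rfl
    · rw [show (x ^^^ y).toNat + 1 = 2 ^ w by omega]
      simp

end Indicates

namespace Expr

/-- The truth value of `x = y`. -/
def eq (x y : Expr) : Expr := .op .div (.const 1) (.op .add (.op .xor x y) (.const 1))

/-- The truth value of the conjunction. -/
def and (x y : Expr) : Expr := .op .and x y

/-- The truth value of the disjunction. -/
def or (x y : Expr) : Expr := .op .or x y

/-- The layer of the vertex in register `a` of the blow-up; the size of a layer is `2 ^ q` times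
the contents of register `R`. -/
def layer (q R a : ℕ) : Expr := .op .div (.var a) (.op .mul (.const (2 ^ q)) (.var R))

/-- The contents of register `a` modulo those of register `R`. -/
def mod (a R : ℕ) : Expr := .op .mod (.var a) (.var R)

/-- The truth value of the relation `BlowUpArc` between the contents of registers `a` and `b`; the
sizes of the parts are in the registers `R` and `R + 1`. -/
def arc (H q R a b : ℕ) : Expr :=
  (((layer q R a).eq (.const 0)).and (((layer q R b).eq (.const 1)).and
    (.input (mod a R) (.op .add (.var R) (mod b (R + 1)))))).or <|
  (((layer q R a).eq (.const H)).and (((layer q R b).eq (.const (H + 1))).and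
    (.input (.op .add (.var R) (mod a (R + 1)))
      (.op .add (.op .add (.var R) (.var (R + 1))) (mod b R))))).or <|
  (((layer q R a).eq (.const (H + 1))).and (((layer q R b).eq (.const 0)).and
    (.input (.op .add (.op .add (.var R) (.var (R + 1))) (mod a R)) (mod b R)))).or <|
  (Expr.op .xor ((layer q R a).eq (.const 0)) (.const 1)).and <|
  ((layer q R b).eq (.op .add (layer q R a) (.const 1))).and <|
  ((Expr.op .div (layer q R b) (.const (H + 1))).eq (.const 0)).and <|
  (mod a (R + 1)).eq (mod b (R + 1))

/-- The truth value of the symmetric closure of `BlowUpArc`. -/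
def edge (H q R a b : ℕ) : Expr := (arc H q R a b).or (arc H q R b a)

theorem arc_below {H q R a b : ℕ} (ha : a < R) (hb : b < R) : (arc H q R a b).Below (R + 2) := by
  have : a < R + 2 := by omega
  have : b < R + 2 := by omega
  simp_all [arc, Expr.eq, Expr.and, Expr.or, layer, mod, Expr.Below]

theorem indicates_eq {w : ℕ} (hw : w ≠ 0) (inp : ℕ → ℕ → Bool) (r : ℕ → BitVec w) (x y : Expr) :
    Indicates ((x.eq y).eval inp r) ((x.eval inp r).toNat = (y.eval inp r).toNat) :=
  Indicates.eq hw _ _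

theorem indicates_input {w : ℕ} (inp : ℕ → ℕ → Bool) (r : ℕ → BitVec w) (x y : Expr) :
    Indicates ((Expr.input x y).eval inp r) (inp (x.eval inp r).toNat (y.eval inp r).toNat) :=
  Indicates.ite _

/-- The bound `hw` rules out overflow in all numbers built from the sizes, so the word operations
compute the true values. The registers `a` and `b` may hold arbitrary words. -/
theorem indicates_arc {w H q R a b N m : ℕ} (inp : ℕ → ℕ → Bool) (hq : 1 ≤ q) (hN : 0 < N)
    (hm : 0 < m) (hmN : m ≤ N) (hH : 1 ≤ H) (hw : (H + 2) * (2 ^ q * N) < 2 ^ w)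
    {r : ℕ → BitVec w} (hrN : r R = BitVec.ofNat w N) (hrm : r (R + 1) = BitVec.ofNat w m) :
    Indicates ((arc H q R a b).eval inp r)
      (BlowUpArc inp N m H (2 ^ q * N) (r a).toNat (r b).toNat) := by
  have h2q : 2 ≤ 2 ^ q := by simpa using Nat.pow_le_pow_right (n := 2) (by norm_num) hq
  have hL : 2 ≤ 2 ^ q * N := h2q.trans (Nat.le_mul_of_pos_right _ hN)
  have h3L : 3 * (2 ^ q * N) < 2 ^ w := (Nat.mul_le_mul_right _ (by omega)).trans_lt hw
  have hHL : (H + 2) * 1 < 2 ^ w := (Nat.mul_le_mul_left _ (by omega)).trans_lt hw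
  have hNL : N ≤ 2 ^ q * N := Nat.le_mul_of_pos_left _ (by omega)
  have hqL : 2 ^ q ≤ 2 ^ q * N := Nat.le_mul_of_pos_right _ hN
  have hw0 : w ≠ 0 := by
    rintro rfl
    simp at hHL
  have tN : (r R).toNat = N := by
    rw [hrN, BitVec.toNat_ofNat, Nat.mod_eq_of_lt (by omega)]
  have tm : (r (R + 1)).toNat = m := by
    rw [hrm, BitVec.toNat_ofNat, Nat.mod_eq_of_lt (by omega)]
  have tconst (k : ℕ) (hk : k < 2 ^ w) : ((Expr.const k).eval inp r).toNat = k := by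
    rw [Expr.eval, BitVec.toNat_ofNat, Nat.mod_eq_of_lt hk]
  have tlayer (c : ℕ) : ((layer q R c).eval inp r).toNat = (r c).toNat / (2 ^ q * N) := by
    simp only [layer, Expr.eval, BinOp.eval, BitVec.toNat_udiv, BitVec.toNat_mul,
      BitVec.toNat_ofNat, tN]
    rw [Nat.mod_eq_of_lt (by omega : 2 ^ q < 2 ^ w), Nat.mod_eq_of_lt (by omega)]
  have tmodN (c : ℕ) : ((mod c R).eval inp r).toNat = (r c).toNat % N := by
    simp only [mod, Expr.eval, BinOp.eval, BitVec.toNat_umod, tN]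
  have tmodm (c : ℕ) : ((mod c (R + 1)).eval inp r).toNat = (r c).toNat % m := by
    simp only [mod, Expr.eval, BinOp.eval, BitVec.toNat_umod, tm]
  have tadd (x y : Expr) (h : (x.eval inp r).toNat + (y.eval inp r).toNat < 2 ^ w) :
      ((Expr.op .add x y).eval inp r).toNat = (x.eval inp r).toNat + (y.eval inp r).toNat := by
    simp only [Expr.eval, BinOp.eval, BitVec.toNat_add]
    exact Nat.mod_eq_of_lt h
  have tvN : ((Expr.var R).eval inp r).toNat = N := tN
  have tvm : ((Expr.var (R + 1)).eval inp r).toNat = m := tm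
  have tB (c : ℕ) : ((Expr.op .add (.var R) (mod c (R + 1))).eval inp r).toNat =
      N + (r c).toNat % m := by
    have := Nat.mod_lt (r c).toNat hm
    rw [tadd _ _ (by rw [tvN, tmodm]; omega), tvN, tmodm]
  have tC (c : ℕ) : ((Expr.op .add (.op .add (.var R) (.var (R + 1))) (mod c R)).eval inp r).toNat =
      N + m + (r c).toNat % N := by
    have := Nat.mod_lt (r c).toNat hN
    have h₁ := tadd (.var R) (.var (R + 1)) (by rw [tvN, tvm]; omega)
    rw [tadd _ _ (by rw [h₁, tvN, tvm, tmodN]; omega), h₁, tvN, tvm, tmodN]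
  -- Since `L ≥ 2`, a layer number is at most half of a word value, and adding `1` cannot overflow
  -- even for words that are not vertices.
  have tsucc (c : ℕ) : ((Expr.op .add (layer q R c) (.const 1)).eval inp r).toNat =
      (r c).toNat / (2 ^ q * N) + 1 := by
    have h₁ : (r c).toNat / (2 ^ q * N) * 2 ≤ (r c).toNat :=
      (Nat.mul_le_mul_left _ hL).trans (Nat.div_mul_le_self _ _)
    have h₂ := (r c).isLt
    rw [tadd _ _ (by rw [tlayer, tconst 1 (by omega)]; omega), tlayer, tconst 1 (by omega)]
  have tdiv (c : ℕ) : ((Expr.op .div (layer q R c) (.const (H + 1))).eval inp r).toNat =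
      (r c).toNat / (2 ^ q * N) / (H + 1) := by
    have h₁ := tlayer c
    have h₂ := tconst (H + 1) (by omega)
    simp only [Expr.eval, BinOp.eval, BitVec.toNat_udiv] at h₁ h₂ ⊢
    rw [h₁, h₂]
  have ilayer (c k : ℕ) (hk : k < 2 ^ w) : Indicates (((layer q R c).eq (.const k)).eval inp r)
      ((r c).toNat / (2 ^ q * N) = k) := by
    have := indicates_eq hw0 inp r (layer q R c) (.const k)
    rwa [tlayer, tconst k hk] at this
  have i₁ := indicates_input inp r (mod a R) (.op .add (.var R) (mod b (R + 1)))
  rw [tmodN, tB] at i₁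
  have i₂ := indicates_input inp r (.op .add (.var R) (mod a (R + 1)))
      (.op .add (.op .add (.var R) (.var (R + 1))) (mod b R))
  rw [tB, tC] at i₂
  have i₃ := indicates_input inp r (.op .add (.op .add (.var R) (.var (R + 1))) (mod a R)) (mod b R)
  rw [tC, tmodN] at i₃
  have i₄ := indicates_eq hw0 inp r (layer q R b) (.op .add (layer q R a) (.const 1))
  rw [tlayer, tsucc] at i₄
  have i₅ := indicates_eq hw0 inp r (.op .div (layer q R b) (.const (H + 1))) (.const 0)
  rw [tdiv, tconst 0 (by omega)] at i₅
  have i₆ := indicates_eq hw0 inp r (mod a (R + 1)) (mod b (R + 1))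
  rw [tmodm, tmodm] at i₆
  have h := ((ilayer a 0 (by omega)).and ((ilayer b 1 (by omega)).and i₁)).or <|
    ((ilayer a H (by omega)).and ((ilayer b (H + 1) (by omega)).and i₂)).or <|
    ((ilayer a (H + 1) (by omega)).and ((ilayer b 0 (by omega)).and i₃)).or <|
    (ilayer a 0 (by omega)).not.and (i₄.and (i₅.and i₆))
  refine h.congr ?_
  unfold BlowUpArc
  -- The comparison with `H` is expressed by a division, as expressions have no order test.
  have h₇ : ∀ l : ℕ, l / (H + 1) = 0 ↔ l ≤ H := by
    intro l
    rw [Nat.div_eq_zero_iff]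
    omega
  simp only [h₇, ne_eq]

end Expr

end WordRAM

open WordRAM

theorem adjInput_eq_true_iff {n : ℕ} {R : Fin n → Fin n → Prop} {i j : ℕ} :
    adjInput R i j = true ↔ ∃ (hi : i < n) (hj : j < n), R ⟨i, hi⟩ ⟨j, hj⟩ := by
  simp [adjInput]

/-! ### Correctness of the reduction. -/

section Reduction

variable {inp : ℕ → ℕ → Bool} {n N m H L : ℕ}

/-- Vertices beyond the `H + 2` layers are isolated, so the expression for the adjacency matrix
needs no range test. -/
theorem BlowUpArc.lt (hH : 1 ≤ H) (hL : 0 < L) (hn : (H + 2) * L ≤ n) {u v : ℕ}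
    (h : BlowUpArc inp N m H L u v) : u < n ∧ v < n := by
  have h₁ := h.layer_le hH
  have h₂ : u / L < H + 2 := by omega
  have h₃ : v / L < H + 2 := by omega
  rw [Nat.div_lt_iff_lt_mul hL] at h₂ h₃
  exact ⟨h₂.trans_le hn, h₃.trans_le hn⟩

theorem adjInput_blowUpDigraph (hH : 1 ≤ H) (hL : 0 < L) (hn : (H + 2) * L ≤ n) {u v : ℕ} :
    adjInput (blowUpDigraph inp n N m H L).Adj u v = true ↔ BlowUpArc inp N m H L u v := by
  rw [adjInput_eq_true_iff]
  exact ⟨fun ⟨_, _, h⟩ => h, fun h => ⟨(h.lt hH hL hn).1, (h.lt hH hL hn).2, h⟩⟩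

theorem adjInput_blowUpGraph (hH : 1 ≤ H) (hL : 0 < L) (hn : (H + 2) * L ≤ n) {u v : ℕ} :
    adjInput (blowUpGraph inp n N m H L hH).Adj u v = true ↔
      BlowUpArc inp N m H L u v ∨ BlowUpArc inp N m H L v u := by
  rw [adjInput_eq_true_iff]
  refine ⟨fun ⟨_, _, h⟩ => h, fun h => ?_⟩
  rcases h with h | h
  · exact ⟨(h.lt hH hL hn).1, (h.lt hH hL hn).2, Or.inl h⟩
  · exact ⟨(h.lt hH hL hn).2, (h.lt hH hL hn).1, Or.inr h⟩

theorem not_cliqueFree_iff {G : SimpleGraph (Fin (N + m + N))} (hG : IsTripartite N m G) :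
    ¬ G.CliqueFree 3 ↔ ∃ x y z, TripartiteTriangle (adjInput G.Adj) N m x y z := by
  classical
  constructor
  · intro h
    simp only [SimpleGraph.CliqueFree, not_forall, not_not] at h
    obtain ⟨s, hs⟩ := h
    obtain ⟨a, b, c, hab, hac, hbc, -⟩ := SimpleGraph.is3Clique_iff.1 hs
    have key : ∀ a b c, G.Adj a b → G.Adj a c → G.Adj b c → part N m a = 0 → part N m b = 1 →
        part N m c = 2 → ∃ x y z, TripartiteTriangle (adjInput G.Adj) N m x y z := by
      intro a b c hab hac hbc ha hb hc
      have ha' : a.val < N := by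
        unfold part at ha
        split_ifs at ha with h₁ h₂ <;> simp_all
      have hb' : ¬ b.val < N ∧ b.val < N + m := by
        unfold part at hb
        split_ifs at hb with h₁ h₂ <;> simp_all
      have hc' : ¬ c.val < N + m := by
        unfold part at hc
        split_ifs at hc with h₁ h₂ <;> simp_all
      have hcl := c.2
      refine ⟨a.val, b.val - N, c.val - (N + m), ha', by omega, by omega, ?_⟩
      rw [Nat.add_sub_cancel' (by omega), Nat.add_sub_cancel' (by omega)]
      simp only [adjInput_eq_true_iff]
      exact ⟨⟨a.2, b.2, hab⟩, ⟨b.2, c.2, hbc⟩, ⟨c.2, a.2, hac.symm⟩⟩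
    have h₁ := hG _ _ hab
    have h₂ := hG _ _ hac
    have h₃ := hG _ _ hbc
    have hcases : ∀ v, part N m v = 0 ∨ part N m v = 1 ∨ part N m v = 2 := by
      intro v
      unfold part
      split_ifs <;> simp
    rcases hcases a with ha | ha | ha <;> rcases hcases b with hb | hb | hb <;>
      rcases hcases c with hc | hc | hc <;> simp only [ha, hb, hc, ne_eq, not_true] at h₁ h₂ h₃
    · exact key a b c hab hac hbc ha hb hc
    · exact key a c b hac hab hbc.symm ha hc hb
    · exact key b a c hab.symm hbc hac hb ha hc
    · exact key c a b hac.symm hbc.symm hab hc ha hb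
    · exact key b c a hbc hab.symm hac.symm hb hc ha
    · exact key c b a hbc.symm hac.symm hab.symm hc hb ha
  · rintro ⟨x, y, z, -, -, -, hxy, hyz, hzx⟩ h
    rw [adjInput_eq_true_iff] at hxy hyz hzx
    obtain ⟨h₁, h₂, hxy⟩ := hxy
    obtain ⟨_, h₃, hyz⟩ := hyz
    obtain ⟨_, _, hzx⟩ := hzx
    exact h _ (SimpleGraph.is3Clique_iff.2 ⟨_, _, _, hxy, hzx.symm, hyz, rfl⟩)

theorem WordRAM.Algorithm.lt_two_pow_wordSize (𝒜 : Algorithm) (n : ℕ) :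
    n < 2 ^ 𝒜.wordSize n := by
  refine (Nat.lt_pow_succ_log_self (b := 2) (by norm_num) n).trans_le ?_
  refine Nat.pow_le_pow_right (by norm_num) ?_
  have := 𝒜.one_le_d
  have := Nat.mul_le_mul_right (Nat.log 2 n) 𝒜.one_le_c
  rw [Algorithm.wordSize]
  omega

variable {p q : ℕ} {t T : ℝ} {𝒜 : Algorithm} {R : ℕ}

theorem DistinguishesDirected.detectsTriangle (hH : 1 ≤ H) (hq : 1 ≤ q)
    (hpq : (H + 2) * 2 ^ q ≤ 2 ^ p) (hR2 : 2 ≤ R) (hR : ∀ I ∈ 𝒜.prog, I.bound ≤ R) (hN : 0 < N)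
    (hm : 0 < m) (hmN : m ≤ N) (ht : t ≤ (2 ^ q * 2 ^ q * (2 ^ q * N / m) ^ H : ℕ)) (hT : 0 ≤ T)
    (h : DistinguishesDirected 𝒜 (H + 2) (2 ^ p * N) t T) :
    DetectsTriangle
      (𝒜.simulation (Expr.arc H q R) R ((Expr.arc H q R 0 0).size + 2) p) N m
      (((Expr.arc H q R 0 0).size + 2 : ℕ) * T + 5) := by
  intro G hG
  have hn : (H + 2) * (2 ^ q * N) ≤ 2 ^ p * N := by
    rw [← mul_assoc]; exact Nat.mul_le_mul_right N hpq
  have hL : 0 < 2 ^ q * N := by positivity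
  have hw := hn.trans_lt (𝒜.lt_two_pow_wordSize (2 ^ p * N))
  have hE : Lookup (adjInput G.Adj)
      (adjInput (blowUpDigraph (adjInput G.Adj) (2 ^ p * N) N m H (2 ^ q * N)).Adj) R
      ((Expr.arc H q R 0 0).size + 2) (BitVec.ofNat (𝒜.wordSize (2 ^ p * N)) N)
      (BitVec.ofNat (𝒜.wordSize (2 ^ p * N)) m) (Expr.arc H q R) :=
    -- The size of the expression does not depend on the registers, so that for `0`, `0` serves for
    -- all.
    { size := fun _ _ => le_rfl
      below := fun a ha b hb => Expr.arc_below ha hb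
      eval := fun a _ b _ r hrN hrm =>
        (Expr.indicates_arc _ hq hN hm hmN hH hw hrN hrm).eq_ite
          (adjInput_blowUpDigraph hH hL hn) }
  obtain ⟨h₁, h₂⟩ := h (blowUpDigraph (adjInput G.Adj) (2 ^ p * N) N m H (2 ^ q * N))
    fun v => BlowUpArc.irrefl hH v
  constructor
  · intro hfree
    have := (not_cliqueFree_iff hG).not.1 (not_not.2 hfree)
    exact (h₁ (blowUpDigraph_cycleCount_eq_zero hH hN hm this)).simulation hN.ne' hR2 hR hE hT
  · intro hfree
    obtain ⟨x, y, z, htri⟩ := (not_cliqueFree_iff hG).1 hfree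
    have hle := le_blowUpDigraph_cycleCount hH htri rfl hn
    exact (h₂ (ht.trans (by exact_mod_cast hle))).simulation hN.ne' hR2 hR hE hT

theorem DistinguishesUndirected.detectsTriangle (hH : 1 ≤ H) (hodd : Odd (H + 2)) (hq : 1 ≤ q)
    (hpq : (H + 2) * 2 ^ q ≤ 2 ^ p) (hR2 : 2 ≤ R) (hR : ∀ I ∈ 𝒜.prog, I.bound ≤ R) (hN : 0 < N)
    (hm : 0 < m) (hmN : m ≤ N) (ht : t ≤ (2 ^ q * 2 ^ q * (2 ^ q * N / m) ^ H : ℕ)) (hT : 0 ≤ T)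
    (h : DistinguishesUndirected 𝒜 (H + 2) (2 ^ p * N) t T) :
    DetectsTriangle
      (𝒜.simulation (Expr.edge H q R) R ((Expr.edge H q R 0 0).size + 2) p) N m
      (((Expr.edge H q R 0 0).size + 2 : ℕ) * T + 5) := by
  intro G hG
  have hn : (H + 2) * (2 ^ q * N) ≤ 2 ^ p * N := by
    rw [← mul_assoc]; exact Nat.mul_le_mul_right N hpq
  have hL : 0 < 2 ^ q * N := by positivity
  have hw := hn.trans_lt (𝒜.lt_two_pow_wordSize (2 ^ p * N))
  have hE : Lookup (adjInput G.Adj)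
      (adjInput (blowUpGraph (adjInput G.Adj) (2 ^ p * N) N m H (2 ^ q * N) hH).Adj) R
      ((Expr.edge H q R 0 0).size + 2) (BitVec.ofNat (𝒜.wordSize (2 ^ p * N)) N)
      (BitVec.ofNat (𝒜.wordSize (2 ^ p * N)) m) (Expr.edge H q R) :=
    { size := fun _ _ => le_rfl
      below := fun a ha b hb => ⟨Expr.arc_below ha hb, Expr.arc_below hb ha⟩
      eval := fun a _ b _ r hrN hrm =>
        ((Expr.indicates_arc _ hq hN hm hmN hH hw hrN hrm).or
          (Expr.indicates_arc _ hq hN hm hmN hH hw hrN hrm)).eq_ite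
          (adjInput_blowUpGraph hH hL hn) }
  obtain ⟨h₁, h₂⟩ := h (blowUpGraph (adjInput G.Adj) (2 ^ p * N) N m H (2 ^ q * N) hH)
  constructor
  · intro hfree
    have := (not_cliqueFree_iff hG).not.1 (not_not.2 hfree)
    exact (h₁ (blowUpGraph_copyCount_eq_zero hH hodd hN hm this)).simulation hN.ne' hR2 hR hE hT
  · intro hfree
    obtain ⟨x, y, z, htri⟩ := (not_cliqueFree_iff hG).1 hfree
    have hle := le_blowUpGraph_copyCount hH htri rfl hn
    exact (h₂ (ht.trans (by exact_mod_cast hle))).simulation hN.ne' hR2 hR hE hT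

end Reduction

/-! ## Asymptotics and conclusion -/

section Asymptotics

open Real

variable {t : ℕ → ℝ} {γ : ℝ} {H : ℕ}

theorem exponent_nonneg (ht : ∀ᶠ n : ℕ in atTop, 1 ≤ t n ∧ t n ≤ (n : ℝ) ^ H)
    (hγ : Tendsto (fun n : ℕ => log (t n) / log n) atTop (𝓝 γ)) : 0 ≤ γ := by
  refine ge_of_tendsto hγ ?_
  filter_upwards [ht, eventually_ge_atTop 1] with n hn h1
  exact div_nonneg (log_nonneg hn.1) (log_nonneg (by exact_mod_cast h1))

theorem eventually_rpow_bounds (ht : ∀ᶠ n : ℕ in atTop, 1 ≤ t n ∧ t n ≤ (n : ℝ) ^ H)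
    (hγ : Tendsto (fun n : ℕ => log (t n) / log n) atTop (𝓝 γ)) {ε : ℝ} (hε : 0 < ε) :
    ∀ᶠ n : ℕ in atTop, (n : ℝ) ^ (γ - ε) ≤ t n ∧ t n ≤ (n : ℝ) ^ (γ + ε) := by
  filter_upwards [ht, eventually_ge_atTop 2,
    hγ.eventually (Ioo_mem_nhds (sub_lt_self γ hε) (lt_add_of_pos_right γ hε))] with n hn h2 h
  have hpos : 0 < log n := log_pos (by exact_mod_cast h2)
  have hn0 : (0 : ℝ) < n := by positivity
  have ht0 : 0 < t n := by linarith [hn.1]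
  obtain ⟨h₁, h₂⟩ := h
  rw [lt_div_iff₀ hpos] at h₁
  rw [div_lt_iff₀ hpos] at h₂
  constructor
  · rw [← log_le_log_iff (by positivity) ht0, log_rpow hn0]
    exact h₁.le
  · rw [← log_le_log_iff ht0 (by positivity), log_rpow hn0]
    exact h₂.le

theorem tendsto_mul_nat {a : ℕ} (ha : 0 < a) : Tendsto (fun N : ℕ => a * N) atTop atTop :=
  tendsto_id.const_mul_atTop' ha

theorem ceil_rpow_le {b : ℝ} (hb : b ≤ 1) {N : ℕ} (hN : 0 < N) : ⌈(N : ℝ) ^ b⌉₊ ≤ N := by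
  rw [Nat.ceil_le]
  calc (N : ℝ) ^ b ≤ (N : ℝ) ^ (1 : ℝ) :=
        rpow_le_rpow_of_exponent_le (by exact_mod_cast hN) hb
    _ = N := rpow_one _

theorem ceil_rpow_pos {b : ℝ} {N : ℕ} (hN : 0 < N) : 0 < ⌈(N : ℝ) ^ b⌉₊ := by
  rw [Nat.ceil_pos]
  positivity

/-- The number of cycles in the blow-up suffices. -/
theorem eventually_le_cycles (hH : 1 ≤ H)
    (ht : ∀ᶠ n : ℕ in atTop, 1 ≤ t n ∧ t n ≤ (n : ℝ) ^ H)
    (hγ : Tendsto (fun n : ℕ => log (t n) / log n) atTop (𝓝 γ)) {η : ℝ} (hη : 0 < η) {a e : ℕ}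
    (ha : 0 < a) (he : 0 < e) (hae : a ^ H ≤ e * e * e ^ H) :
    ∀ᶠ N : ℕ in atTop, t (a * N) ≤
      (e * e * (e * N / ⌈(N : ℝ) ^ max 0 (1 - γ / H - η)⌉₊) ^ H : ℕ) := by
  have hH0 : (0 : ℝ) < H := by exact_mod_cast hH
  have hγ0 := exponent_nonneg ht hγ
  -- If the exponent is truncated to `0`, then `m = 1` and the trivial bound `t n ≤ n ^ H` suffices,
  -- thanks to `hae`.
  rcases le_or_gt (1 - γ / H - η) 0 with hb | hb
  · filter_upwards [(tendsto_mul_nat ha).eventually ht] with N hN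
    rw [max_eq_left hb]
    refine hN.2.trans ?_
    have : (a * N) ^ H ≤ e * e * (e * N) ^ H := by
      rw [mul_pow, mul_pow, ← mul_assoc]
      exact Nat.mul_le_mul_right _ hae
    simpa using (by exact_mod_cast this : ((a * N : ℕ) : ℝ) ^ H ≤ (e * e * (e * N) ^ H : ℕ))
  · rw [max_eq_right hb.le]
    set b := 1 - γ / H - η with hbdef
    have hb1 : b ≤ 1 := by
      have : 0 ≤ γ / H := by positivity
      linarith
    -- The slack is a factor `N ^ (H * η)`: one half absorbs the error in the exponent of `t`, the
    -- other half the constants.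
    have hε : 0 < H * η / 2 := by positivity
    have hlarge : ∀ᶠ N : ℕ in atTop,
        (4 : ℝ) ^ H * (a : ℝ) ^ (γ + H * η / 2) ≤ (N : ℝ) ^ (H * η / 2) :=
      ((tendsto_rpow_atTop hε).comp tendsto_natCast_atTop_atTop).eventually_ge_atTop _
    filter_upwards [(tendsto_mul_nat ha).eventually (eventually_rpow_bounds ht hγ hε), hlarge,
      eventually_ge_atTop 1] with N hN hl h1
    have hN0 : (0 : ℝ) < N := by exact_mod_cast h1
    set m := ⌈(N : ℝ) ^ b⌉₊ with hm
    have hm0 : 0 < m := ceil_rpow_pos h1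
    have hmN : m ≤ N := ceil_rpow_le hb1 h1
    have hmle : (m : ℝ) ≤ 2 * (N : ℝ) ^ b := by
      have h₁ := (Nat.ceil_lt_add_one (rpow_nonneg hN0.le b)).le
      have h₂ : 1 ≤ (N : ℝ) ^ b := one_le_rpow (by exact_mod_cast h1) hb.le
      rw [← hm] at h₁
      linarith
    -- One factor `2` is lost to the ceiling in `m`, another to the floor in the quotient.
    have hdiv : (N : ℝ) ^ (1 - b) / 4 ≤ (e * N / m : ℕ) := by
      have h₁ : N / m ≤ e * N / m := Nat.div_le_div_right (Nat.le_mul_of_pos_left N he)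
      have h₂ : N ≤ 2 * m * (N / m) := by
        have h₃ := Nat.mod_add_div N m
        have h₄ := Nat.mod_lt N hm0
        have h₅ : 1 ≤ N / m := Nat.div_pos hmN hm0
        nlinarith
      have h₂' : (N : ℝ) ≤ 2 * m * (N / m : ℕ) := by exact_mod_cast h₂
      have h₁' : ((N / m : ℕ) : ℝ) ≤ (e * N / m : ℕ) := by exact_mod_cast h₁
      refine le_trans ?_ h₁'
      have hbp : 0 < (N : ℝ) ^ b := by positivity
      rw [rpow_sub hN0, rpow_one, div_div, div_le_iff₀ (by positivity)]
      refine h₂'.trans ?_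
      have := mul_le_mul_of_nonneg_right hmle (Nat.cast_nonneg (α := ℝ) (N / m))
      linarith
    have hpow : ((N : ℝ) ^ (1 - b) / 4) ^ H ≤ ((e * N / m : ℕ) : ℝ) ^ H :=
      pow_le_pow_left₀ (by positivity) hdiv H
    have hexp : ((N : ℝ) ^ (1 - b)) ^ H = (N : ℝ) ^ (γ + H * η / 2) * (N : ℝ) ^ (H * η / 2) := by
      rw [← rpow_natCast, ← rpow_mul hN0.le, ← rpow_add hN0]
      congr 1
      rw [hbdef]
      field_simp
      ring
    have hee : (1 : ℝ) ≤ e * e := by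
      exact_mod_cast Nat.mul_pos he he
    calc t (a * N) ≤ ((a * N : ℕ) : ℝ) ^ (γ + H * η / 2) := hN.2
      _ = (a : ℝ) ^ (γ + H * η / 2) * (N : ℝ) ^ (γ + H * η / 2) := by
        push_cast
        exact mul_rpow (by positivity) (by positivity)
      _ ≤ (N : ℝ) ^ (H * η / 2) / 4 ^ H * (N : ℝ) ^ (γ + H * η / 2) := by
        gcongr
        rw [le_div_iff₀ (by positivity), mul_comm]
        exact hl
      _ = ((N : ℝ) ^ (1 - b) / 4) ^ H := by rw [div_pow, hexp]; ring
      _ ≤ ((e * N / m : ℕ) : ℝ) ^ H := hpow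
      _ ≤ (e * e) * ((e * N / m : ℕ) : ℝ) ^ H := le_mul_of_one_le_left (by positivity) hee
      _ = _ := by push_cast; ring

theorem sq_le_MM (F : Type*) [Field F] {N m : ℕ} (hm : 0 < m) : (N : ℝ) ^ 2 ≤ MM F N m N := by
  have := le_MM F N m N hm.ne'
  rw [← sq] at this
  exact_mod_cast this

/-- The complexity of the matrix product for the blow-up is almost linear in that for the original
graph. -/
theorem eventually_MM_le (F : Type*) [Field F] (hH : 1 ≤ H)
    (ht : ∀ᶠ n : ℕ in atTop, 1 ≤ t n ∧ t n ≤ (n : ℝ) ^ H)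
    (hγ : Tendsto (fun n : ℕ => log (t n) / log n) atTop (𝓝 γ)) {η : ℝ} (hη : 0 < η) {a : ℕ}
    (ha : 0 < a) : ∃ C : ℝ, 0 < C ∧ ∀ᶠ N : ℕ in atTop,
      (MM F (a * N) ⌈((a * N : ℕ) : ℝ) / t (a * N) ^ (1 / (H : ℝ))⌉₊ (a * N) : ℝ) ≤
        C * (MM F N ⌈(N : ℝ) ^ max 0 (1 - γ / H - η)⌉₊ N : ℝ) ^ (1 + η) := by
  have hH0 : (0 : ℝ) < H := by exact_mod_cast hH
  have ha0 : (0 : ℝ) < a := by exact_mod_cast ha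
  -- This is `(a ^ (1 - γ / H + η) + 2) * (2 * a ^ 2)`: the first factor bounds the number of slices
  -- divided by `N ^ (2 * η)`, with the `2` from two roundings up; the second bounds the cost of one
  -- slice divided by that of the small product.
  refine ⟨(a : ℝ) ^ (1 - γ / H + η) * (2 * a ^ 2) + 2 * (2 * a ^ 2), by positivity, ?_⟩
  filter_upwards [(tendsto_mul_nat ha).eventually
    (eventually_rpow_bounds ht hγ (by positivity : 0 < H * η)), eventually_ge_atTop 1] with N hN h1
  have hN0 : (0 : ℝ) < N := by exact_mod_cast h1
  have hN1 : (1 : ℝ) ≤ N := by exact_mod_cast h1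
  set n := a * N with hn
  have hn0 : (0 : ℝ) < n := by rw [hn]; push_cast; positivity
  set b := max 0 (1 - γ / H - η) with hb
  set m := ⌈(N : ℝ) ^ b⌉₊ with hm
  set q := ⌈(n : ℝ) / t n ^ (1 / (H : ℝ))⌉₊ with hq
  have hm0 : 0 < m := ceil_rpow_pos h1
  have hm0' : (0 : ℝ) < m := by exact_mod_cast hm0
  have hm1 : (1 : ℝ) ≤ m := by exact_mod_cast hm0
  have hmN : (N : ℝ) ^ (1 - γ / H - η) ≤ m :=
    (rpow_le_rpow_of_exponent_le hN1 (le_max_right _ _)).trans (Nat.le_ceil _)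
  have ht0 : 0 < t n := lt_of_lt_of_le (by positivity) hN.1
  have hqle : (q : ℝ) ≤ (n : ℝ) ^ (1 - γ / H + η) + 1 := by
    have h₁ : (n : ℝ) ^ (γ / H - η) ≤ t n ^ (1 / (H : ℝ)) := by
      have := rpow_le_rpow (by positivity) hN.1 (by positivity : 0 ≤ 1 / (H : ℝ))
      rw [← rpow_mul hn0.le] at this
      convert this using 2
      field_simp
    have h₂ : (n : ℝ) / t n ^ (1 / (H : ℝ)) ≤ (n : ℝ) ^ (1 - γ / H + η) := by
      rw [div_le_iff₀ (by positivity)]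
      calc (n : ℝ) = (n : ℝ) ^ (1 - γ / H + η) * (n : ℝ) ^ (γ / H - η) := by
            rw [← rpow_add hn0]
            ring_nf
            exact (rpow_one _).symm
        _ ≤ _ := by gcongr
    exact (Nat.ceil_lt_add_one (by positivity)).le.trans (by linarith)
  have hQ : ((q ⌈/⌉ m : ℕ) : ℝ) ≤ ((a : ℝ) ^ (1 - γ / H + η) + 2) * (N : ℝ) ^ (2 * η) := by
    have h₁ : ((q ⌈/⌉ m : ℕ) : ℝ) ≤ (q + m) / m := by
      rw [Nat.ceilDiv_eq_add_pred_div]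
      refine Nat.cast_div_le.trans ?_
      gcongr
      exact_mod_cast (by omega : q + m - 1 ≤ q + m)
    have h₂ : (n : ℝ) ^ (1 - γ / H + η) ≤ (a : ℝ) ^ (1 - γ / H + η) * (N : ℝ) ^ (2 * η) * m := by
      rw [hn, Nat.cast_mul, mul_rpow ha0.le hN0.le, mul_assoc]
      gcongr
      calc (N : ℝ) ^ (1 - γ / H + η) = (N : ℝ) ^ (2 * η) * (N : ℝ) ^ (1 - γ / H - η) := by
            rw [← rpow_add hN0]; ring_nf
        _ ≤ _ := by gcongr
    have h₃ : 1 ≤ (N : ℝ) ^ (2 * η) := one_le_rpow hN1 (by positivity)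
    refine h₁.trans ?_
    rw [div_le_iff₀ hm0']
    nlinarith [mul_le_mul h₃ hm1 zero_le_one (by positivity)]
  have hMN := sq_le_MM F (N := N) hm0
  set M : ℝ := (MM F N m N : ℝ) with hM
  have hM0 : 0 < M := lt_of_lt_of_le (by positivity) hMN
  have hblocks : (MM F n q n : ℝ) ≤ (q ⌈/⌉ m : ℕ) * (2 * a ^ 2 * M) := by
    have := MM_blocks_le F a a N q N m hm0.ne'
    have h₁ : (MM F n q n : ℝ) ≤ (q ⌈/⌉ m : ℕ) * (a * a * M + a * N * (a * N)) := by
      rw [hM, hn]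
      exact_mod_cast this
    refine h₁.trans ?_
    gcongr
    nlinarith [mul_le_mul_of_nonneg_left hMN (sq_nonneg (a : ℝ))]
  -- The quadratic lower bound on `M` turns the number of slices into a small power of `M`.
  have hNM : (N : ℝ) ^ (2 * η) ≤ M ^ η := by
    rw [rpow_mul hN0.le, rpow_two]
    exact rpow_le_rpow (by positivity) hMN hη.le
  calc (MM F n q n : ℝ) ≤ (q ⌈/⌉ m : ℕ) * (2 * a ^ 2 * M) := hblocks
    _ ≤ ((a : ℝ) ^ (1 - γ / H + η) + 2) * M ^ η * (2 * a ^ 2 * M) := by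
      gcongr
      exact hQ.trans (by gcongr)
    _ = _ := by rw [rpow_add hM0, rpow_one]; ring

end Asymptotics

theorem DetectsTriangle.mono {𝒜 : WordRAM.Algorithm} {n m : ℕ} {T T' : ℝ}
    (h : DetectsTriangle 𝒜 n m T) (hT : T ≤ T') : DetectsTriangle 𝒜 n m T' := fun G hG =>
  ⟨fun hf => ((h G hG).1 hf).mono hT, fun hf => ((h G hG).2 hf).mono hT⟩

theorem DistinguishesDirected.mono {𝒜 : WordRAM.Algorithm} {h n : ℕ} {t T T' : ℝ}
    (hd : DistinguishesDirected 𝒜 h n t T) (hT : T ≤ T') : DistinguishesDirected 𝒜 h n t T' :=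
  fun G hG => ⟨fun hf => ((hd G hG).1 hf).mono hT, fun hf => ((hd G hG).2 hf).mono hT⟩

theorem DistinguishesUndirected.mono {𝒜 : WordRAM.Algorithm} {h n : ℕ} {t T T' : ℝ}
    (hd : DistinguishesUndirected 𝒜 h n t T) (hT : T ≤ T') :
    DistinguishesUndirected 𝒜 h n t T' :=
  fun G => ⟨fun hf => ((hd G).1 hf).mono hT, fun hf => ((hd G).2 hf).mono hT⟩

/-- No problem that triangle detection reduces to can be solved too fast. Here `P n T` says that the
problem of size `n` can be solved in time `T`. -/
theorem UnbalancedTriangleHypothesis.false_of_reduction {F : Type*} [Field F]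
    (hyp : UnbalancedTriangleHypothesis F) {H : ℕ} (hH : 1 ≤ H) {t : ℕ → ℝ} {γ : ℝ}
    (ht : ∀ᶠ n : ℕ in atTop, 1 ≤ t n ∧ t n ≤ (n : ℝ) ^ H)
    (hγ : Tendsto (fun n : ℕ => Real.log (t n) / Real.log n) atTop (𝓝 γ))
    {P : ℕ → ℝ → Prop} (hP : ∀ {n T T'}, P n T → T ≤ T' → P n T')
    {p q : ℕ} (hpq : (2 ^ p) ^ H ≤ 2 ^ q * 2 ^ q * (2 ^ q) ^ H) (ℬ : WordRAM.Algorithm) (S : ℕ)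
    (hred : ∀ N m T, 0 < N → 0 < m → m ≤ N →
      t (2 ^ p * N) ≤ (2 ^ q * 2 ^ q * (2 ^ q * N / m) ^ H : ℕ) → 0 ≤ T → P (2 ^ p * N) T →
      DetectsTriangle ℬ N m (S * T + 5))
    {δ K : ℝ} (hδ : 0 < δ) (hK : ∀ᶠ n : ℕ in atTop,
      P n (K * (MM F n ⌈(n : ℝ) / t n ^ (1 / (H : ℝ))⌉₊ n : ℝ) ^ (1 - δ))) : False := by
  have hH0 : (0 : ℝ) < H := by exact_mod_cast hH
  have h2p : 0 < 2 ^ p := by positivity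
  -- `2 * η ≤ δ` lets `1 - 2 * η` replace `1 - δ`, and `2 * η ≤ 1 / 2` keeps this exponent positive.
  set η := min δ (1 / 2) / 2 with hη
  have hη0 : 0 < η := by positivity
  have hηδ : 2 * η ≤ δ := by rw [hη]; linarith [min_le_left δ (1 / 2)]
  have hη1 : 2 * η ≤ 1 / 2 := by rw [hη]; linarith [min_le_right δ (1 / 2)]
  have hγ0 : 0 ≤ γ / H := div_nonneg (exponent_nonneg ht hγ) hH0.le
  obtain ⟨C, hC, hMM⟩ := eventually_MM_le F hH ht hγ hη0 h2p
  have hb1 : max 0 (1 - γ / H - η) ≤ 1 := max_le zero_le_one (by linarith)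
  refine hyp _ (le_max_left 0 (1 - γ / H - η)) hb1 η hη0
    ⟨ℬ, S * (|K| * C ^ (1 - 2 * η)) + 5, ?_⟩
  filter_upwards [hMM, eventually_le_cycles hH ht hγ hη0 h2p (e := 2 ^ q) (by positivity) hpq,
    (tendsto_mul_nat h2p).eventually hK, (tendsto_mul_nat h2p).eventually ht,
    eventually_ge_atTop 1] with N hle hcyc hPN htN h1
  have hn0 : (0 : ℝ) < (2 ^ p * N : ℕ) := by
    have : 0 < 2 ^ p * N := Nat.mul_pos h2p h1
    exact_mod_cast this
  have hn1 : (1 : ℝ) ≤ (2 ^ p * N : ℕ) := by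
    have : 0 < 2 ^ p * N := Nat.mul_pos h2p h1
    exact_mod_cast this
  have hN1 : (1 : ℝ) ≤ N := by exact_mod_cast h1
  have hm0 : 0 < ⌈(N : ℝ) ^ max 0 (1 - γ / H - η)⌉₊ := ceil_rpow_pos h1
  have hM : (1 : ℝ) ≤ MM F N ⌈(N : ℝ) ^ max 0 (1 - γ / H - η)⌉₊ N :=
    (one_le_pow₀ hN1).trans (sq_le_MM F hm0)
  set M : ℝ := (MM F N ⌈(N : ℝ) ^ max 0 (1 - γ / H - η)⌉₊ N : ℝ)
  have hq0 : 0 < ⌈((2 ^ p * N : ℕ) : ℝ) / t (2 ^ p * N) ^ (1 / (H : ℝ))⌉₊ := by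
    rw [Nat.ceil_pos]
    have : 0 < t (2 ^ p * N) := by linarith [htN.1]
    positivity
  have hM' := (one_le_pow₀ hn1).trans (sq_le_MM F hq0)
  set M' : ℝ :=
    (MM F (2 ^ p * N) ⌈((2 ^ p * N : ℕ) : ℝ) / t (2 ^ p * N) ^ (1 / (H : ℝ))⌉₊ (2 ^ p * N) : ℝ)
  have hT : K * M' ^ (1 - δ) ≤ |K| * C ^ (1 - 2 * η) * M ^ (1 - η) := by
    calc K * M' ^ (1 - δ) ≤ |K| * M' ^ (1 - 2 * η) := by
          refine mul_le_mul (le_abs_self K) ?_ (by positivity) (abs_nonneg K)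
          exact Real.rpow_le_rpow_of_exponent_le hM' (by linarith)
      _ ≤ |K| * (C * M ^ (1 + η)) ^ (1 - 2 * η) := by
          gcongr
          linarith
      _ = |K| * C ^ (1 - 2 * η) * M ^ ((1 + η) * (1 - 2 * η)) := by
          rw [Real.mul_rpow hC.le (by positivity), ← Real.rpow_mul (by positivity), mul_assoc]
      -- `(1 + η) * (1 - 2 * η) = 1 - η - 2 * η ^ 2`, so a saving of `η` remains.
      _ ≤ _ := by
          gcongr
          nlinarith
  refine (hred N _ _ h1 hm0 (ceil_rpow_le hb1 h1) hcyc (by positivity) (hP hPN hT)).mono ?_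
  have : 1 ≤ M ^ (1 - η) := Real.one_le_rpow hM (by linarith)
  linarith

theorem mainTheorem2 {F : Type*} [Field F] (hyp : UnbalancedTriangleHypothesis F)
    (h : ℕ) (hh : 3 ≤ h) (t : ℕ → ℝ) (γ : ℝ)
    (ht : ∀ᶠ n : ℕ in atTop, 1 ≤ t n ∧ t n ≤ (n : ℝ) ^ (h - 2))
    (hγ : Tendsto (fun n : ℕ => Real.log (t n) / Real.log n) atTop (𝓝 γ)) :
    (∀ δ : ℝ, 0 < δ → ¬ ∃ (𝒜 : WordRAM.Algorithm) (K : ℝ), ∀ᶠ n : ℕ in atTop,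
      DistinguishesDirected 𝒜 h n (t n)
        (K * (MM F n ⌈(n : ℝ) / t n ^ (1 / ((h : ℝ) - 2))⌉₊ n : ℝ) ^ (1 - δ))) ∧
    (Odd h → ∀ δ : ℝ, 0 < δ → ¬ ∃ (𝒜 : WordRAM.Algorithm) (K : ℝ), ∀ᶠ n : ℕ in atTop,
      DistinguishesUndirected 𝒜 h n (t n)
        (K * (MM F n ⌈(n : ℝ) / t n ^ (1 / ((h : ℝ) - 2))⌉₊ n : ℝ) ^ (1 - δ))) := by
  obtain ⟨H, rfl⟩ := Nat.exists_eq_add_of_le' (by omega : 2 ≤ h)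
  have hH : 1 ≤ H := by omega
  rw [Nat.add_sub_cancel] at ht
  have hcast : ((H + 2 : ℕ) : ℝ) - 2 = H := by push_cast; ring
  rw [hcast]
  -- The gap `p - q = H + 2` makes room for `H + 2` layers of size `2 ^ q * N`. It costs a factor `2
  -- ^ ((H + 2) * H)` in the number of cycles required, which this `q` makes equal to `2 ^ q`; the
  -- copies in the two outer layers supply `2 ^ q * 2 ^ q`.
  set q := (H + 2) * H with hq
  set p := q + (H + 2) with hp
  have hq1 : 1 ≤ q := by rw [hq]; nlinarith
  have hlayers : (H + 2) * 2 ^ q ≤ 2 ^ p := by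
    rw [hp, pow_add, mul_comm]
    exact Nat.mul_le_mul_left _ Nat.lt_two_pow_self.le
  have hpq : (2 ^ p) ^ H ≤ 2 ^ q * 2 ^ q * (2 ^ q) ^ H := by
    rw [hp, pow_add, mul_pow, ← pow_mul 2 (H + 2) H, ← hq, mul_comm]
    exact Nat.mul_le_mul_right _ (Nat.le_mul_of_pos_left _ (by positivity))
  constructor
  · rintro δ hδ ⟨𝒜, K, hK⟩
    obtain ⟨R, hR2, hR⟩ := WordRAM.exists_bound 𝒜.prog
    exact hyp.false_of_reduction hH ht hγ (fun hd hT => hd.mono hT) hpq _ _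
      (fun _ _ _ hN hm hmN hcyc hT hd => hd.detectsTriangle hH hq1 hlayers hR2 hR hN hm hmN hcyc hT)
      hδ hK
  · rintro hodd δ hδ ⟨𝒜, K, hK⟩
    obtain ⟨R, hR2, hR⟩ := WordRAM.exists_bound 𝒜.prog
    exact hyp.false_of_reduction hH ht hγ (fun hd hT => hd.mono hT) hpq _ _
      (fun _ _ _ hN hm hmN hcyc hT hd =>
        hd.detectsTriangle hH hodd hq1 hlayers hR2 hR hN hm hmN hcyc hT)
      hδ hK
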